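/- All graphs are finite, simple and undirected; the graph with no vertices is allowed. A graph $G$ is \emph{induced universal} for a family of graphs if every member of the family is isomorphic to an induced subgraph of $G$. For an integer $k \ge 0$, let $\mathcal{F}(k)$ be the family of all graphs on $k$ vertices, let $f(k)$ be the minimum number of vertices of a graph that is induced universal for $\mathcal{F}(k)$, and let $F(k)$ be the number of isomorphism classes of graphs with exactly $f(k)$ vertices that are induced universal for $\mathcal{F}(k)$. Then \[ \begin{array}{c|cccccc} k & 0 & 1 & 2 & 3 & 4 & 5\\ \hline f(k) & 0 & 1 & 3 & 5 & 8 & 10\\ F(k) & 1 & 1 & 2 & 5 & 438 & 22 \end{array} \] -/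

import Mathlib

namespace InducedUniversal

/-- `G` is induced universal for the family `𝓕`: every member of `𝓕` is isomorphic to an induced
subgraph of `G` (Mathlib's graph embeddings preserve and reflect adjacency). -/
def IsInducedUniversal {W V : Type*} (𝓕 : Set (SimpleGraph W)) (G : SimpleGraph V) : Prop :=
  ∀ H ∈ 𝓕, Nonempty (H ↪g G)

/-- The family of all graphs on `k` vertices, represented on the vertex set `Fin k`. -/
def allGraphs (k : ℕ) : Set (SimpleGraph (Fin k)) := Set.univ

/-- Representing the family on `Fin k` loses nothing: a graph that is induced universal for
`allGraphs k` contains every graph on every `k`-element vertex type. -/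
theorem IsInducedUniversal.exists_embedding {k : ℕ} {V : Type*} {G : SimpleGraph V}
    (hG : IsInducedUniversal (allGraphs k) G) {W : Type*} [Fintype W] (hW : Fintype.card W = k)
    (H : SimpleGraph W) : Nonempty (H ↪g G) := by
  let e : W ≃ Fin k := Fintype.equivFinOfCardEq hW
  obtain ⟨φ⟩ := hG (H.map e.toEmbedding) (Set.mem_univ _)
  exact ⟨(SimpleGraph.Iso.map e H).toEmbedding.trans φ⟩

/-- The orders of the finite graphs that are induced universal for the graphs on `k` vertices. -/
def universalOrders (k : ℕ) : Set ℕ :=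
  {n | ∃ G : SimpleGraph (Fin n), IsInducedUniversal (allGraphs k) G}

/-- Induced universality is invariant under isomorphism of the host graph. -/
theorem IsInducedUniversal.of_iso {W V V' : Type*} {𝓕 : Set (SimpleGraph W)} {G : SimpleGraph V}
    {G' : SimpleGraph V'} (hG : IsInducedUniversal 𝓕 G) (e : G ≃g G') :
    IsInducedUniversal 𝓕 G' :=
  fun H hH => (hG H hH).map fun φ => φ.trans e.toEmbedding

/-- Some finite graph is induced universal, for instance the disjoint union of all graphs on
`Fin k`. -/
theorem universalOrders_nonempty (k : ℕ) : (universalOrders k).Nonempty := by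
  classical
  let U : SimpleGraph (SimpleGraph (Fin k) × Fin k) :=
    { Adj := fun x y => x.1 = y.1 ∧ x.1.Adj x.2 y.2
      symm := ⟨by
        rintro ⟨H, a⟩ ⟨H', b⟩ ⟨h, hab⟩
        dsimp only at h hab ⊢
        subst h
        exact ⟨rfl, hab.symm⟩⟩
      loopless := ⟨fun x hx => hx.2.ne rfl⟩ }
  have hU : IsInducedUniversal (allGraphs k) U := fun H _ =>
    ⟨⟨⟨fun a => (H, a), fun a b h => (Prod.mk.inj h).2⟩, by
      intro a b
      exact ⟨fun h => h.2, fun h => ⟨rfl, h⟩⟩⟩⟩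
  let e := Fintype.equivFin (SimpleGraph (Fin k) × Fin k)
  exact ⟨_, U.map e.toEmbedding, hU.of_iso (SimpleGraph.Iso.map e U)⟩

/-- `f(k)`: the order of a minimal induced universal graph for the family of all graphs on `k`
vertices. -/
noncomputable def f (k : ℕ) : ℕ := sInf (universalOrders k)

/-- `f k` is a genuine minimum. -/
theorem f_isLeast (k : ℕ) : IsLeast (universalOrders k) (f k) :=
  ⟨Nat.sInf_mem (universalOrders_nonempty k), fun _ hn => Nat.sInf_le hn⟩

/-- The graphs on the vertex set `Fin n` that are induced universal for the family of all graphs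
on `k` vertices. -/
def UniversalGraph (k n : ℕ) : Type :=
  {G : SimpleGraph (Fin n) // IsInducedUniversal (allGraphs k) G}

/-- Two such graphs are identified when they are isomorphic. -/
def isoSetoid (k n : ℕ) : Setoid (UniversalGraph k n) where
  r G G' := Nonempty (G.1 ≃g G'.1)
  iseqv :=
    ⟨fun _ => ⟨SimpleGraph.Iso.refl⟩, fun ⟨e⟩ => ⟨e.symm⟩, fun ⟨e⟩ ⟨e'⟩ => ⟨e.trans e'⟩⟩

/-- `F(k)`: the number of isomorphism classes of graphs of order `f k` that are induced universal
for the family of all graphs on `k` vertices. -/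
noncomputable def F (k : ℕ) : ℕ := Nat.card (Quotient (isoSetoid k (f k)))

/-- The set of isomorphism classes is finite, so `F k` is a genuine count. -/
theorem finite_quotient (k n : ℕ) : Finite (Quotient (isoSetoid k n)) := by
  have : Finite (UniversalGraph k n) := by
    unfold UniversalGraph
    infer_instance
  infer_instance

end InducedUniversal

namespace InducedUniversal

/-! A graph that is induced universal for the graphs on `k` vertices contains a clique `K` and an
independent set `I` of order `k`. They share at most one vertex, so the order is at least `2k - 1`.
For `k = 4` and `k = 5` the cycle on `k` vertices is not a split graph, so some vertex `x` lies
outside `K ∪ I` and the order is at least `2k`.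

In order `2k` the sets `K` and `I` must share a vertex `c`, and `x` is the only vertex outside their
union. Only the pairs at `x` and the pairs between `K \ {c}` and `I \ {c}` remain undetermined: 7 +
9 = 16 pairs for `k = 4`, and 9 + 16 = 25 for `k = 5`. In the latter case a 5-cycle passes through
`x`, two vertices of `K \ I` and two of `I \ K`, which fixes eight more pairs and leaves 17. Hence
every candidate lies, up to isomorphism, in a family of `2 ^ 16` or `2 ^ 17` graphs
(`exists_iso_eight`, `exists_iso_ten`). For `k ≤ 3` the family of all graphs of the relevant order
is small enough.

The rest is a computation on the whole family at once. A subset of the family is a number whose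
digit `p` stands for the member `p`. A backtracking search for a given graph carries along the set
of members in which the current partial embedding is valid, so that bitwise operations treat all
members simultaneously (`testBit_search`). Searching for each graph on `k` vertices leaves the
universal members (`testBit_containingAll`). The same search, applied to a graph of full order,
tests isomorphism: picking a survivor, deleting its isomorphic copies and repeating gives one
representative per class (`pairwise_classes`, `exists_mem_classes`). Members that some obvious
symmetry makes smaller are discarded beforehand, which loses no class (`exists_minimal`).
`card_quotient` combines these facts, and a nonzero count also shows that the lower bound on the
order is attained (`f_eq_and_F_eq`). -/

theorem natBeq_eq_false {a b : ℕ} (h : a ≠ b) : Nat.beq a b = false :=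
  Bool.eq_false_iff.2 fun e => h (Nat.eq_of_beq_eq_true e)

/-! ### Truth tables

A set of assignments `p < 2 ^ m` is stored as the number whose `p`-th binary digit tells whether
`p` belongs to it. The functions below are evaluated by the kernel, so they are written with
recursors and the binary operations of `Nat`. -/

/-- The set of all assignments `p < 2 ^ m`. -/
def full (m : ℕ) : ℕ := Nat.sub (Nat.pow 2 (Nat.pow 2 m)) 1

/-- The set of the assignments `p < 2 ^ m` whose `i`-th binary digit is `1`. -/
def truthTable : ℕ → ℕ → ℕ
  | 0, _ => 0
  | m + 1, i => cond (Nat.beq i m) (Nat.shiftLeft (full m) (Nat.pow 2 m))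
      ((fun t => Nat.lor t (Nat.shiftLeft t (Nat.pow 2 m))) (truthTable m i))

theorem testBit_full (m t : ℕ) : (full m).testBit t = decide (t < 2 ^ m) := by
  simp [full, Nat.testBit_two_pow_sub_one]

theorem truthTable_lt (m i : ℕ) : truthTable m i < 2 ^ 2 ^ m := by
  have aux : ∀ m x : ℕ, x < 2 ^ 2 ^ m → x <<< 2 ^ m < 2 ^ 2 ^ (m + 1) := by
    intro m x hx
    rw [Nat.shiftLeft_eq, pow_succ 2 m, mul_two, pow_add]
    exact Nat.mul_lt_mul_of_pos_right hx (by positivity)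
  induction m with
  | zero => simp [truthTable]
  | succ m ih =>
    have hle : 2 ^ 2 ^ m ≤ 2 ^ 2 ^ (m + 1) :=
      Nat.pow_le_pow_right (by norm_num) (Nat.pow_le_pow_right (by norm_num) (Nat.le_succ m))
    rw [truthTable]
    cases Nat.beq i m with
    | true =>
      refine aux m _ ?_
      have : 0 < 2 ^ 2 ^ m := by positivity
      change 2 ^ 2 ^ m - 1 < _
      omega
    | false => exact Nat.or_lt_two_pow (ih.trans_le hle) (aux m _ ih)

/-- When the range of assignments is doubled, digit `m` is constant on each half, and every other
digit repeats on the upper half. -/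
theorem testBit_truthTable {m t : ℕ} (i : ℕ) (ht : t < 2 ^ m) :
    (truthTable m i).testBit t = t.testBit i := by
  induction m generalizing t with
  | zero => simp_all [truthTable]
  | succ m ih =>
    have hhigh : ∀ s, s < 2 ^ m → (2 ^ m + s).testBit i = if i = m then true else s.testBit i := by
      intro s hs
      split_ifs with h
      · subst h; simp [Nat.testBit_two_pow_add_eq, Nat.testBit_lt_two_pow hs]
      · rcases lt_or_gt_of_ne h with h | h
        · exact Nat.testBit_two_pow_add_gt h s
        · rw [Nat.testBit_lt_two_pow, Nat.testBit_lt_two_pow]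
          · exact hs.trans (Nat.pow_lt_pow_right (by norm_num) h)
          · calc 2 ^ m + s < 2 ^ (m + 1) := by rw [pow_succ]; omega
              _ ≤ 2 ^ i := Nat.pow_le_pow_right (by norm_num) h
    -- The unshifted copy of the table contributes nothing to the upper half.
    have hcut : (truthTable m i).testBit t =
        (decide (t < 2 ^ m) && (truthTable m i).testBit t) := by
      by_cases h : t < 2 ^ m
      · simp [h]
      · simp [h, Nat.testBit_lt_two_pow ((truthTable_lt m i).trans_le
          (Nat.pow_le_pow_right (by norm_num) (not_lt.1 h)))]
    rw [truthTable]
    rcases lt_or_ge t (2 ^ m) with h | h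
    · have key : ∀ x : ℕ, (x <<< 2 ^ m).testBit t = false := by
        intro x; simp [Nat.testBit_shiftLeft, h]
      by_cases hi : i = m
      · subst hi
        simp only [Nat.beq_refl, cond_true]
        exact (key _).trans (Nat.testBit_lt_two_pow h).symm
      · rw [show Nat.beq i m = false from natBeq_eq_false hi]
        simp only [cond_false]
        change (_ ||| _ <<< 2 ^ m).testBit t = _
        rw [Nat.testBit_or, key, Bool.or_false, ih h]
    · obtain ⟨s, rfl⟩ := Nat.exists_eq_add_of_le h
      have hs : s < 2 ^ m := by rw [pow_succ] at ht; omega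
      have key : ∀ x : ℕ, (x <<< 2 ^ m).testBit (2 ^ m + s) = x.testBit s := by
        intro x; simp [Nat.testBit_shiftLeft]
      rw [hhigh s hs]
      by_cases hi : i = m
      · subst hi
        simp only [Nat.beq_refl, cond_true, if_true]
        refine (key _).trans ?_
        simp [testBit_full, hs]
      · rw [show Nat.beq i m = false from natBeq_eq_false hi, if_neg hi]
        simp only [cond_false]
        change (_ ||| _ <<< 2 ^ m).testBit _ = _
        rw [Nat.testBit_or, key, hcut]
        simp [ih hs]

/-- A digit `1` of `x`, if `x` is a nonzero number below `2 ^ 2 ^ m`. -/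
def someBit : ℕ → ℕ → ℕ
  | 0, _ => 0
  | m + 1, x => (fun y => cond (Nat.beq y 0) (someBit m x) (Nat.add (Nat.pow 2 m) (someBit m y)))
      (Nat.shiftRight x (Nat.pow 2 m))

/-- Bisection: the upper half is searched if it is nonzero; otherwise `x` equals its lower half. -/
theorem someBit_spec {m x : ℕ} (h0 : x ≠ 0) (hx : x < 2 ^ 2 ^ m) :
    someBit m x < 2 ^ m ∧ x.testBit (someBit m x) = true := by
  induction m generalizing x with
  | zero =>
    have : x = 1 := by simp at hx; omega
    subst this; simp [someBit]
  | succ m ih =>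
    rw [someBit]
    have hsr : Nat.shiftRight x (Nat.pow 2 m) = x >>> 2 ^ m := rfl
    rw [hsr]
    by_cases hy : x >>> 2 ^ m = 0
    · have hlt : x < 2 ^ 2 ^ m := by
        rw [Nat.shiftRight_eq_div_pow] at hy
        exact (Nat.div_eq_zero_iff.1 hy).resolve_left (by positivity)
      have := ih h0 hlt
      simp only [hy, Nat.beq_refl, cond_true]
      exact ⟨this.1.trans (Nat.pow_lt_pow_right (by norm_num) (Nat.lt_succ_self m)), this.2⟩
    · have hlt : x >>> 2 ^ m < 2 ^ 2 ^ m := by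
        rw [Nat.shiftRight_eq_div_pow]
        refine Nat.div_lt_of_lt_mul ?_
        rwa [← pow_add, ← two_mul, ← pow_succ']
      have := ih hy hlt
      simp only [show Nat.beq (x >>> 2 ^ m) 0 = false from natBeq_eq_false hy, cond_false]
      change 2 ^ m + someBit m (x >>> 2 ^ m) < _ ∧
        x.testBit (2 ^ m + someBit m (x >>> 2 ^ m)) = true
      rw [Nat.testBit_shiftRight] at this
      exact ⟨by rw [pow_succ]; omega, this.2⟩

/-! ### Searching for a graph in all members of a family at once -/

section Search

variable {α : Type} (F : α → ℕ → ℕ → ℕ) (M : ℕ → ℕ → Bool → ℕ)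

/-- The members of `mask` in which `v` has the prescribed adjacencies `row` to the vertices `us`. -/
def place (v : ℕ) (row : List Bool) : List ℕ → ℕ → ℕ :=
  @List.rec Bool (fun _ => List ℕ → ℕ → ℕ) (fun _ mask => mask)
    (fun b _ ih us mask => @Bool.rec (fun _ => ℕ)
      (@List.rec ℕ (fun _ => ℕ) mask
        (fun u us' _ => ih us' (Nat.land mask
          (@Bool.rec (fun _ => ℕ) (M u v false) (M u v true) b))) us)
      0 (Nat.beq mask 0)) row

/-- The members of `mask` in which the vertices `us` cannot be extended by vertices from `vs` with
labels and adjacencies as prescribed by `rows`. -/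
def search (vs : List ℕ) (rows : List (α × List Bool)) : List ℕ → ℕ → ℕ :=
  @List.rec (α × List Bool) (fun _ => List ℕ → ℕ → ℕ) (fun _ _ => 0)
    (fun r _ ih us mask => @List.rec ℕ (fun _ => ℕ → ℕ) (fun mask => mask)
      (fun v _ ih' mask => (fun found => @Bool.rec (fun _ => ℕ)
          ((fun found => @Bool.rec (fun _ => ℕ)
              (ih' (Nat.xor mask (Nat.xor found (ih (v :: us) found))))
              (ih' mask) (Nat.beq found 0))
            (place M v r.2 us found))
          (ih' mask) (Nat.beq found 0))
        (F r.1 v mask)) vs mask) rows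

/-- The vertices `us` can be extended by vertices from `vs` with labels and adjacencies as
prescribed by the rows; `S` is the labelling and `R` the adjacency relation. -/
def Extends (S : α → ℕ → Prop) (R : ℕ → ℕ → Bool → Prop) (vs : List ℕ) :
    List (α × List Bool) → List ℕ → Prop
  | [], _ => True
  | r :: rows, us => ∃ v ∈ vs, S r.1 v ∧ (∀ e ∈ r.2.zip us, R e.2 v e.1) ∧
      Extends S R vs rows (v :: us)

variable {F M} {S : α → ℕ → Prop} {R : ℕ → ℕ → Bool → Prop} {t : ℕ}

theorem testBit_place (hM : ∀ u v b, (M u v b).testBit t = true ↔ R u v b) (v : ℕ) (row : List Bool)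
    (us : List ℕ) (mask : ℕ) :
    (place M v row us mask).testBit t = true ↔
      mask.testBit t = true ∧ ∀ e ∈ row.zip us, R e.2 v e.1 := by
  induction row generalizing us mask with
  | nil => simp [place]
  | cons b row ih =>
    by_cases h0 : mask = 0
    · subst h0; simp [place]
    · have hb : Nat.beq mask 0 = false := natBeq_eq_false h0
      cases us with
      | nil => simp [place, hb]
      | cons u us =>
        have h1 : place M v (b :: row) (u :: us) mask =
            place M v row us (mask &&& M u v b) := by
          cases b <;> simp only [place, hb] <;> rfl
        rw [h1, ih, Nat.testBit_and, Bool.and_eq_true, hM]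
        simp [and_assoc]

/-- One candidate vertex, seen from one member: `a`, `b`, `c` tell whether the member is still in
the set, admits the candidate, and admits it but cannot be extended further. The xor deletes the
members where the candidate succeeds; `W` stands for the later candidates. -/
theorem search_step {a b c : Bool} {P Q E W : Prop} (hb : b = true ↔ (a = true ∧ P) ∧ Q)
    (hc : c = true ↔ b = true ∧ ¬ E) :
    ((a ^^ (b ^^ c)) = true ∧ ¬ W) ↔ a = true ∧ ¬ (P ∧ Q ∧ E ∨ W) := by
  cases a <;> cases b <;> cases c <;> simp at hb hc ⊢ <;> tauto

/-- Digits never interact, so it suffices that `M` and `F` are correct at the single digit `t`. -/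
theorem testBit_search (hM : ∀ u v b, (M u v b).testBit t = true ↔ R u v b)
    (hF : ∀ l v mask, (F l v mask).testBit t = true ↔ mask.testBit t = true ∧ S l v)
    (vs : List ℕ) (rows : List (α × List Bool)) (us : List ℕ) (mask : ℕ) :
    (search F M vs rows us mask).testBit t = true ↔
      mask.testBit t = true ∧ ¬ Extends S R vs rows us := by
  induction rows generalizing us mask with
  | nil => simp [search, Extends]
  | cons r rows ih =>
    suffices H : ∀ ws : List ℕ, ∀ mask : ℕ,
        ((@List.rec ℕ (fun _ => ℕ → ℕ) (fun mask => mask)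
          (fun v _ ih' mask => (fun found => @Bool.rec (fun _ => ℕ)
              ((fun found => @Bool.rec (fun _ => ℕ)
                  (ih' (Nat.xor mask (Nat.xor found (search F M vs rows (v :: us) found))))
                  (ih' mask) (Nat.beq found 0))
                (place M v r.2 us found))
              (ih' mask) (Nat.beq found 0))
            (F r.1 v mask)) ws mask).testBit t = true ↔
          mask.testBit t = true ∧ ¬ ∃ v ∈ ws, S r.1 v ∧ (∀ e ∈ r.2.zip us, R e.2 v e.1) ∧
            Extends S R vs rows (v :: us)) from H vs mask
    intro ws
    induction ws with
    | nil => simp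
    | cons v ws ihw =>
      intro mask
      have hp := testBit_place hM v r.2 us (F r.1 v mask)
      have hf := hF r.1 v mask
      rw [hf] at hp
      dsimp only
      -- A branch that no member enters is skipped; this is the case `c = false` of `search_step`.
      have hzero : ∀ found : ℕ, found = 0 → (found.testBit t = true ↔
          (mask.testBit t = true ∧ S r.1 v) ∧ ∀ e ∈ r.2.zip us, R e.2 v e.1) →
          (mask.testBit t = true ∧ (¬ ∃ v ∈ ws, S r.1 v ∧ (∀ e ∈ r.2.zip us, R e.2 v e.1) ∧
            Extends S R vs rows (v :: us)) ↔
          mask.testBit t = true ∧ ¬ ∃ w ∈ v :: ws, S r.1 w ∧ (∀ e ∈ r.2.zip us, R e.2 w e.1) ∧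
            Extends S R vs rows (w :: us)) := by
        rintro _ rfl hp
        simp only [List.exists_mem_cons_iff]
        simpa using search_step (W := ∃ v ∈ ws, S r.1 v ∧ (∀ e ∈ r.2.zip us, R e.2 v e.1) ∧
          Extends S R vs rows (v :: us)) hp (c := false) (E := Extends S R vs rows (v :: us))
          (by simp)
      by_cases h1 : F r.1 v mask = 0
      · rw [h1] at hf ⊢
        rw [h1] at hp
        simp only [Nat.beq_refl]
        rw [ihw]
        exact hzero 0 rfl (by
          rw [← hf]
          simp only [Nat.zero_testBit, Bool.false_eq_true, false_and])
      · simp only [natBeq_eq_false h1]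
        generalize place M v r.2 us (F r.1 v mask) = found at hp
        have hih := ih (v :: us) found
        by_cases h0 : found = 0
        · simp only [h0, Nat.beq_refl]
          rw [ihw]
          exact hzero found h0 hp
        · simp only [natBeq_eq_false h0]
          rw [ihw]
          have hx : (Nat.xor mask (Nat.xor found (search F M vs rows (v :: us) found))).testBit t =
              (mask.testBit t ^^ (found.testBit t ^^
                (search F M vs rows (v :: us) found).testBit t)) := by
            rw [← Nat.testBit_xor, ← Nat.testBit_xor]; rfl
          rw [hx]
          simp only [List.exists_mem_cons_iff]
          exact search_step hp hih

end Search

/-! ### Prescribed rows and partial embeddings -/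

/-- The adjacencies of `d` to `u - 1`, …, `0`. -/
def prevRow (h : ℕ → ℕ → Bool) (d : ℕ) : ℕ → List Bool
  | 0 => []
  | u + 1 => h u d :: prevRow h d u

/-- The labels of the vertices `d`, `d + 1`, …, `d + r - 1` and their adjacencies to all earlier
vertices, the last of these first. -/
def rowsFrom {α : Type} (lab : ℕ → α) (h : ℕ → ℕ → Bool) : ℕ → ℕ → List (α × List Bool)
  | _, 0 => []
  | d, r + 1 => (lab d, prevRow h d d) :: rowsFrom lab h (d + 1) r

/-- The values of `φ` at `d - 1`, …, `0`. -/
def prevVals (φ : ℕ → ℕ) : ℕ → List ℕ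
  | 0 => []
  | d + 1 => φ d :: prevVals φ d

theorem forall_mem_zip_prev (h : ℕ → ℕ → Bool) (R : ℕ → ℕ → Bool → Prop) (φ : ℕ → ℕ) (v d u : ℕ) :
    (∀ e ∈ (prevRow h d u).zip (prevVals φ u), R e.2 v e.1) ↔ ∀ i < u, R (φ i) v (h i d) := by
  induction u with
  | zero => simp [prevRow]
  | succ u ih =>
    simp only [prevRow, prevVals, List.zip_cons_cons, List.forall_mem_cons, ih,
      Nat.forall_lt_succ_right, and_comm]

theorem prevVals_congr {φ ψ : ℕ → ℕ} {d : ℕ} (h : ∀ i < d, φ i = ψ i) :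
    prevVals φ d = prevVals ψ d := by
  induction d with
  | zero => rfl
  | succ d ih => rw [prevVals, prevVals, h d (Nat.lt_succ_self d), ih fun i hi => h i (by omega)]

/-- Only the values of `φ` below `d` matter, and choosing the next vertex amounts to updating `φ` at
`d`. -/
theorem extends_iff {α : Type} (S : α → ℕ → Prop) (R : ℕ → ℕ → Bool → Prop) (vs : List ℕ)
    (lab : ℕ → α) (h : ℕ → ℕ → Bool) (d r : ℕ) (φ : ℕ → ℕ) :
    Extends S R vs (rowsFrom lab h d r) (prevVals φ d) ↔
      ∃ ψ : ℕ → ℕ, (∀ i < d, ψ i = φ i) ∧ ∀ j, d ≤ j → j < d + r →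
        ψ j ∈ vs ∧ S (lab j) (ψ j) ∧ ∀ i < j, R (ψ i) (ψ j) (h i j) := by
  induction r generalizing d φ with
  | zero =>
    simp only [rowsFrom, Extends, true_iff]
    exact ⟨φ, fun _ _ => rfl, fun j h1 h2 => by omega⟩
  | succ r ih =>
    simp only [rowsFrom, Extends, forall_mem_zip_prev]
    constructor
    · rintro ⟨v, hv, hS, hR, hE⟩
      have hφ : v :: prevVals φ d = prevVals (Function.update φ d v) (d + 1) := by
        rw [prevVals, Function.update_self]
        congr 1
        exact prevVals_congr fun i hi => (Function.update_of_ne hi.ne _ _).symm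
      rw [hφ, ih] at hE
      obtain ⟨ψ, h1, h2⟩ := hE
      have hlow : ∀ i < d, ψ i = φ i := fun i hi => by
        rw [h1 i (by omega), Function.update_of_ne hi.ne]
      have hd : ψ d = v := by rw [h1 d (by omega), Function.update_self]
      refine ⟨ψ, hlow, fun j hj1 hj2 => ?_⟩
      rcases hj1.eq_or_lt with rfl | hlt
      · rw [hd]
        exact ⟨hv, hS, fun i hi => by rw [hlow i hi]; exact hR i hi⟩
      · exact h2 j hlt (by omega)
    · rintro ⟨ψ, h1, h2⟩
      obtain ⟨hv, hS, hR⟩ := h2 d le_rfl (by omega)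
      refine ⟨ψ d, hv, hS, fun i hi => by rw [← h1 i hi]; exact hR i hi, ?_⟩
      rw [← prevVals_congr h1]
      change Extends S R vs _ (prevVals ψ (d + 1))
      rw [ih]
      exact ⟨ψ, fun _ _ => rfl, fun j hj1 hj2 => h2 j (by omega) (by omega)⟩

/-! ### Families of graphs given by a pattern -/

/-- A lower triangular table. An entry `0` stands for a non-edge, `1` for an edge, and `l + 2` for
an edge that is present when the `l`-th binary digit of the parameter is `1`. -/
abbrev Pattern := List (List ℕ)

namespace Pattern

variable (T : Pattern)

/-- The entry for the pair `i`, `j`. -/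
def cell (i j : ℕ) : ℕ := (T.getD (max i j) []).getD (min i j) 0

/-- Adjacency of `i` and `j` in the member with parameter `p`. -/
def adj (p i j : ℕ) : Bool :=
  match T.cell i j with
  | 0 => false
  | 1 => true
  | l + 2 => Nat.beq (Nat.mod (Nat.shiftRight p l) 2) 1

/-- The parameters for which `i` and `j` are adjacent. -/
def mask (m i j : ℕ) : ℕ :=
  match T.cell i j with
  | 0 => 0
  | 1 => full m
  | l + 2 => truthTable m l

/-- The parameters for which `i` and `j` are distinct, and adjacent or not according to `b`. -/
def lit (m u v : ℕ) (b : Bool) : ℕ :=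
  cond (Nat.beq u v) 0 (cond b (T.mask m u v) (Nat.xor (full m) (T.mask m u v)))

theorem cell_comm (i j : ℕ) : T.cell i j = T.cell j i := by
  rw [cell, cell, max_comm, min_comm]

theorem adj_comm (p i j : ℕ) : T.adj p i j = T.adj p j i := by
  rw [adj, adj, cell_comm]

/-- The member with parameter `p` of the family of graphs on `n` vertices. -/
def graph (n p : ℕ) : SimpleGraph (Fin n) where
  Adj i j := i ≠ j ∧ T.adj p i j = true
  symm := ⟨fun i j h => ⟨h.1.symm, by rw [adj_comm]; exact h.2⟩⟩
  loopless := ⟨fun _ h => h.1 rfl⟩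

theorem adj_of_cell {p i j l : ℕ} (h : T.cell i j = l + 2) : T.adj p i j = p.testBit l := by
  rw [adj, h]
  change Nat.beq (p >>> l % 2) 1 = _
  rw [Nat.testBit_eq_decide_div_mod_eq, Nat.shiftRight_eq_div_pow]
  by_cases h1 : p / 2 ^ l % 2 = 1
  · simp [h1]
  · simp [h1, natBeq_eq_false h1]

variable {T} {m t : ℕ}

theorem testBit_mask (ht : t < 2 ^ m) (i j : ℕ) : (T.mask m i j).testBit t = T.adj t i j := by
  rcases h : T.cell i j with _ | _ | l
  · simp [mask, adj, h]
  · simp [mask, adj, h, testBit_full, ht]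
  · rw [adj_of_cell T h, mask, h]
    exact testBit_truthTable l ht

theorem testBit_lit (ht : t < 2 ^ m) (u v : ℕ) (b : Bool) :
    (T.lit m u v b).testBit t = true ↔ u ≠ v ∧ T.adj t u v = b := by
  rw [lit]
  by_cases h : u = v
  · subst h; simp
  · rw [natBeq_eq_false h]
    cases b
    · have : (Nat.xor (full m) (T.mask m u v)).testBit t = (true ^^ T.adj t u v) := by
        rw [← testBit_mask ht, ← show (full m).testBit t = true by simp [testBit_full, ht],
          ← Nat.testBit_xor]
        rfl
      simp only [cond_false, this]
      simp [h]
    · simp [h, testBit_mask ht]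

/-- The pattern prescribes at most the first `m` binary digits, each of them for one pair. -/
def Valid (T : Pattern) (n m : ℕ) : Prop :=
  ∀ j < n, ∀ i < j, T.cell i j < m + 2 ∧
    (T.cell i j < 2 ∨ ∀ j' < n, ∀ i' < j', T.cell i' j' ≠ T.cell i j ∨ i' = i ∧ j' = j)

set_option synthInstance.maxSize 1000 in
instance (n m : ℕ) : Decidable (T.Valid n m) := by unfold Valid; infer_instance

/-- Every graph with the prescribed edges and non-edges is a member of the family. -/
theorem exists_graph_eq {n : ℕ} (hT : T.Valid n m) (G : SimpleGraph (Fin n))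
    (hG : ∀ i j : Fin n, i < j → (T.cell i j = 0 → ¬ G.Adj i j) ∧ (T.cell i j = 1 → G.Adj i j)) :
    ∃ p < 2 ^ m, T.graph n p = G := by
  classical
  -- Each digit belongs to at most one pair, so the existential reads off the adjacency of that
  -- pair.
  let b : Fin m → Bool := fun l => decide (∃ i j : Fin n, i < j ∧ T.cell i j = l + 2 ∧ G.Adj i j)
  have hlt : ∀ i j : Fin n, i < j → (T.adj (Nat.ofBits b) i j = true ↔ G.Adj i j) := by
    intro i j hij
    obtain ⟨h1, h2⟩ := hT j j.2 i hij
    rcases h : T.cell i j with _ | _ | l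
    · simp [adj, h, (hG i j hij).1 h]
    · simp [adj, h, (hG i j hij).2 h]
    · have hl : l < m := by omega
      rw [adj_of_cell T h, Nat.testBit_ofBits_lt _ _ hl]
      simp only [b, decide_eq_true_eq]
      constructor
      · rintro ⟨i', j', hij', h', hadj⟩
        obtain ⟨hi, hj⟩ := (h2.resolve_left (by omega) j' j'.2 i' hij').resolve_left
          (not_not.2 (h'.trans h.symm))
        rwa [Fin.ext hi, Fin.ext hj] at hadj
      · exact fun hadj => ⟨i, j, hij, h, hadj⟩
  refine ⟨Nat.ofBits b, Nat.ofBits_lt_two_pow b, ?_⟩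
  ext i j
  rcases lt_trichotomy i j with h | rfl | h
  · simp [graph, h.ne, hlt i j h]
  · simp [graph]
  · rw [SimpleGraph.adj_comm, SimpleGraph.adj_comm G]
    simp [graph, h.ne, hlt j i h]

/-! ### Induced subgraphs -/

/-- Thanks to this, the search for embeddings also decides isomorphism. -/
theorem nonempty_iso_of_embedding {n : ℕ} {G G' : SimpleGraph (Fin n)} (φ : G ↪g G') :
    Nonempty (G ≃g G') :=
  ⟨⟨Equiv.ofBijective φ (Finite.injective_iff_bijective.1 φ.injective), φ.map_rel_iff⟩⟩

theorem extends_iff_exists_embedding {n k : ℕ} {vs : List ℕ} (hvs : vs = List.range n)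
    {α : Type} (S : α → ℕ → Prop) (lab : ℕ → α) (h : ℕ → ℕ → Bool) (H : SimpleGraph (Fin k))
    (hH : ∀ i j : Fin k, i < j → (h i j = true ↔ H.Adj i j)) :
    Extends S (fun u v b => u ≠ v ∧ T.adj t u v = b) vs (rowsFrom lab h 0 k) [] ↔
      ∃ φ : H ↪g T.graph n t, ∀ i : Fin k, S (lab i) (φ i) := by
  have := extends_iff S (fun u v b => u ≠ v ∧ T.adj t u v = b) vs lab h 0 k id
  rw [show prevVals id 0 = [] from rfl] at this
  rw [this]
  subst hvs
  simp only [List.mem_range, Nat.zero_le, zero_add, Nat.not_lt_zero, false_imp_iff, implies_true,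
    true_and, true_imp_iff]
  constructor
  · rintro ⟨ψ, hψ⟩
    have hne : ∀ i j : Fin k, i < j → ψ i ≠ ψ j := fun i j hij => ((hψ j j.2).2.2 i hij).1
    have hadj : ∀ i j : Fin k, i < j → (T.adj t (ψ i) (ψ j) = true ↔ H.Adj i j) :=
      fun i j hij => by rw [((hψ j j.2).2.2 i hij).2, hH i j hij]
    refine ⟨⟨⟨fun i => ⟨ψ i, (hψ i i.2).1⟩, fun i j hij => ?_⟩, ?_⟩, fun i => (hψ i i.2).2.1⟩
    · by_contra hne'
      rcases lt_or_gt_of_ne hne' with h | h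
      · exact hne i j h (Fin.mk.inj hij)
      · exact hne j i h (Fin.mk.inj hij).symm
    · intro i j
      change (_ ∧ T.adj t (ψ i) (ψ j) = true) ↔ _
      rcases lt_trichotomy i j with h | rfl | h
      · rw [hadj i j h, and_iff_right]
        exact fun e => hne i j h (Fin.mk.inj e)
      · simp
      · rw [adj_comm, hadj j i h, SimpleGraph.adj_comm, and_iff_right]
        exact fun e => hne j i h (Fin.mk.inj e).symm
  · rintro ⟨φ, hφ⟩
    refine ⟨fun i => if hi : i < k then φ ⟨i, hi⟩ else 0, fun j hj => ?_⟩
    have hφj := hφ ⟨j, hj⟩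
    simp only [hj, dif_pos]
    refine ⟨(φ ⟨j, hj⟩).2, hφj, fun i hij => ?_⟩
    have hi := hij.trans hj
    simp only [hi, dif_pos]
    have hlt : (⟨i, hi⟩ : Fin k) < ⟨j, hj⟩ := hij
    have hne : φ ⟨i, hi⟩ ≠ φ ⟨j, hj⟩ := fun e => hlt.ne (φ.injective e)
    have h1 := (φ.map_rel_iff (a := ⟨i, hi⟩) (b := ⟨j, hj⟩)).trans (hH _ _ hlt).symm
    refine ⟨fun e => hne (Fin.ext e), Bool.eq_iff_iff.2 ?_⟩
    rw [← h1]
    exact ⟨fun h => ⟨hne, h⟩, fun h => h.2⟩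

variable (T)

/-- The parameters in `U` whose graph does not contain the graph `h` of the pattern `P`. -/
def avoiding (m : ℕ) (vs : List ℕ) (P : Pattern) (k h U : ℕ) : ℕ :=
  search (fun _ _ mask => mask) (T.lit m) vs (rowsFrom (fun _ => ()) (P.adj h) 0 k) [] U

variable {T}

theorem testBit_avoiding {n : ℕ} {vs : List ℕ} (hvs : vs = List.range n) (ht : t < 2 ^ m)
    (P : Pattern) (k h U : ℕ) :
    (T.avoiding m vs P k h U).testBit t = true ↔
      U.testBit t = true ∧ ¬ Nonempty (P.graph k h ↪g T.graph n t) := by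
  rw [avoiding, testBit_search (S := fun _ _ => True) (fun u v b => testBit_lit ht u v b) (by simp),
    extends_iff_exists_embedding hvs _ _ _ (P.graph k h) fun i j hij => by simp [graph, hij.ne]]
  simp only [implies_true, exists_const_iff, and_true]

/-- With the digits of `lit` themselves as the relation, no bound on `t` is needed; such bounds are
later deduced from membership in `U`. -/
theorem testBit_of_avoiding {vs : List ℕ} {P : Pattern} {k h U : ℕ}
    (ht : (T.avoiding m vs P k h U).testBit t = true) : U.testBit t = true :=
  ((testBit_search (S := fun _ _ => True) (R := fun u v b => (T.lit m u v b).testBit t = true)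
    (fun _ _ _ => Iff.rfl) (by simp) _ _ _ _).1 ht).1

variable (T)

/-- The parameters in `U` whose graph contains none of the graphs `hs` of the pattern `P`. -/
def avoidingAll (m : ℕ) (vs : List ℕ) (P : Pattern) (k : ℕ) : List ℕ → ℕ → ℕ
  | [], U => U
  | h :: hs, U => avoidingAll m vs P k hs (T.avoiding m vs P k h U)

/-- The parameters in `U` whose graph contains all of the graphs `hs` of the pattern `P`. -/
def containingAll (m : ℕ) (vs : List ℕ) (P : Pattern) (k : ℕ) : List ℕ → ℕ → ℕ
  | [], U => U
  | h :: hs, U => containingAll m vs P k hs (Nat.xor U (T.avoiding m vs P k h U))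

variable {T}

theorem testBit_avoidingAll {n : ℕ} {vs : List ℕ} (hvs : vs = List.range n) (ht : t < 2 ^ m)
    (P : Pattern) (k : ℕ) (hs : List ℕ) (U : ℕ) :
    (T.avoidingAll m vs P k hs U).testBit t = true ↔
      U.testBit t = true ∧ ∀ h ∈ hs, ¬ Nonempty (P.graph k h ↪g T.graph n t) := by
  induction hs generalizing U with
  | nil => simp [avoidingAll]
  | cons h hs ih => rw [avoidingAll, ih, testBit_avoiding hvs ht, List.forall_mem_cons, and_assoc]

/-- The avoiding members form a subset of `U`, so the xor is a set difference. -/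
theorem testBit_xor_avoiding {n : ℕ} {vs : List ℕ} (hvs : vs = List.range n) (ht : t < 2 ^ m)
    (P : Pattern) (k h U : ℕ) :
    (Nat.xor U (T.avoiding m vs P k h U)).testBit t = true ↔
      U.testBit t = true ∧ Nonempty (P.graph k h ↪g T.graph n t) := by
  have h1 := testBit_avoiding (T := T) hvs ht P k h U
  have h2 : (Nat.xor U (T.avoiding m vs P k h U)).testBit t =
      (U.testBit t ^^ (T.avoiding m vs P k h U).testBit t) := Nat.testBit_xor ..
  rw [h2]
  cases h3 : U.testBit t <;> cases h4 : (T.avoiding m vs P k h U).testBit t <;>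
    simp_all

theorem testBit_containingAll {n : ℕ} {vs : List ℕ} (hvs : vs = List.range n) (ht : t < 2 ^ m)
    (P : Pattern) (k : ℕ) (hs : List ℕ) (U : ℕ) :
    (T.containingAll m vs P k hs U).testBit t = true ↔
      U.testBit t = true ∧ ∀ h ∈ hs, Nonempty (P.graph k h ↪g T.graph n t) := by
  induction hs generalizing U with
  | nil => simp [containingAll]
  | cons h hs ih =>
    rw [containingAll, ih, testBit_xor_avoiding hvs ht, List.forall_mem_cons, and_assoc]

theorem testBit_of_containingAll {vs : List ℕ} {P : Pattern} {k : ℕ} {hs : List ℕ} {U : ℕ}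
    (ht : (T.containingAll m vs P k hs U).testBit t = true) : U.testBit t = true := by
  induction hs generalizing U with
  | nil => exact ht
  | cons h hs ih =>
    have h1 := ih ht
    have h2 : (Nat.xor U (T.avoiding m vs P k h U)).testBit t =
      (U.testBit t ^^ (T.avoiding m vs P k h U).testBit t) := Nat.testBit_xor ..
    cases h3 : U.testBit t with
    | true => rfl
    | false =>
      have h4 : (T.avoiding m vs P k h U).testBit t = false :=
        Bool.eq_false_iff.2 fun h => by simp [testBit_of_avoiding h] at h3
      rw [h2, h3, h4] at h1
      exact h1

/-! ### Isomorphism classes -/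

variable (T)

/-- The number of entries of a list that satisfy `g`. -/
def count (g : ℕ → Bool) (us : List ℕ) : ℕ :=
  @List.rec ℕ (fun _ => ℕ) 0
    (fun u _ ih => @Bool.rec (fun _ => ℕ) ih (Nat.add ih 1) (g u)) us

/-- The parameters that belong to exactly `d` of the sets `A u`, for `u` in a list. -/
def countMask (m : ℕ) (A : ℕ → ℕ) : List ℕ → ℕ → ℕ
  | [], 0 => full m
  | [], _ + 1 => 0
  | u :: us, d => Nat.lor (Nat.land (countMask m A us d) (Nat.xor (full m) (A u)))
      (match d with
        | 0 => 0
        | d + 1 => Nat.land (countMask m A us d) (A u))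

/-- The `i`-th entry of a list of numbers, `0` if there is none. -/
def lookup (l : List ℕ) : ℕ → ℕ :=
  @List.rec ℕ (fun _ => ℕ → ℕ) (fun _ => 0)
    (fun a _ ih i => @Nat.rec (fun _ => ℕ) a (fun j _ => ih j) i) l

/-- `u` and `v` are adjacent vertices of the member with parameter `p`. -/
def nbr (p v u : ℕ) : Bool := @Bool.rec (fun _ => Bool) (T.adj p u v) false (Nat.beq u v)

/-- The degree of the vertex `v` in the member with parameter `p`. -/
def degree (vs : List ℕ) (p v : ℕ) : ℕ := count (T.nbr p v) vs

/-- The number of neighbours of small degree of `v` in the member with parameter `p`. -/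
def lowDegree (n : ℕ) (vs : List ℕ) (p v : ℕ) : ℕ :=
  count (fun u => @Bool.rec (fun _ => Bool) false
    (Nat.ble (Nat.add (T.degree vs p u) (T.degree vs p u)) n) (T.nbr p v u)) vs

/-- The parameters for which `v` has degree `d`. -/
def degreeMask (m : ℕ) (vs : List ℕ) (v d : ℕ) : ℕ := countMask m (fun u => T.lit m u v true) vs d

/-- The parameters for which `v` has small degree. -/
def lowMask (m n : ℕ) (vs : List ℕ) (v : ℕ) : ℕ :=
  (List.range (n + 1)).foldr (fun d mask =>
    cond (Nat.ble (Nat.add d d) n) (Nat.lor (T.degreeMask m vs v d) mask) mask) 0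

/-- The parameters for which `v` has exactly `d` neighbours of small degree. -/
def lowDegreeMask (m n : ℕ) (vs : List ℕ) (v d : ℕ) : ℕ :=
  countMask m (fun u => Nat.land (T.lit m u v true) (T.lowMask m n vs u)) vs d

/-- The members of `mask` in which `v` has degree `l.1` and `l.2` neighbours of small degree. -/
def degreeFilter (m n : ℕ) (vs : List ℕ) (l : ℕ × ℕ) (v mask : ℕ) : ℕ :=
  Nat.land (Nat.land mask (lookup ((List.range (n + 1)).map (T.degreeMask m vs v)) l.1))
    (lookup ((List.range (n + 1)).map (T.lowDegreeMask m n vs v)) l.2)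

/-- The parameters in `U` whose graph is not isomorphic to the one with parameter `p`. -/
def nonIsomorphic (m n : ℕ) (vs : List ℕ) (p U : ℕ) : ℕ :=
  search (T.degreeFilter m n vs) (T.lit m) vs
    (rowsFrom (fun i => (T.degree vs p i, T.lowDegree n vs p i)) (T.adj p) 0 n) [] U

/-- Parameters of representatives of the isomorphism classes of the graphs with parameters in `U`,
at most `fuel` of them. -/
def classes (m n : ℕ) (vs : List ℕ) : ℕ → ℕ → List ℕ
  | 0, _ => []
  | fuel + 1, U => cond (Nat.beq U 0) []
      ((fun p => p :: classes m n vs fuel (T.nonIsomorphic m n vs p U)) (someBit m U))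

variable {T}

/-- A Pascal-type recursion: the head is either not counted, leaving `d` to the tail, or counted,
leaving `d - 1`. -/
theorem testBit_countMask (ht : t < 2 ^ m) {A : ℕ → ℕ} {g : ℕ → Bool}
    (hA : ∀ u, (A u).testBit t = g u) (us : List ℕ) (d : ℕ) :
    (countMask m A us d).testBit t = true ↔ count g us = d := by
  induction us generalizing d with
  | nil => cases d <;> simp [countMask, count, testBit_full, ht]
  | cons u us ih =>
    have hmask : countMask m A (u :: us) d = (countMask m A us d &&& (full m ^^^ A u)) |||
        (match d with
          | 0 => 0
          | d + 1 => Nat.land (countMask m A us d) (A u)) := by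
      cases d <;> rfl
    have hcount : count g (u :: us) =
      @Bool.rec (fun _ => ℕ) (count g us) (count g us + 1) (g u) := rfl
    rw [hmask, hcount, Nat.testBit_or, Nat.testBit_and, Nat.testBit_xor, Bool.or_eq_true,
      Bool.and_eq_true, ih, hA, testBit_full]
    cases d with
    | zero => cases g u <;> simp [ht]
    | succ d =>
      change _ ∨ Nat.testBit (_ &&& _) t = true ↔ _
      rw [Nat.testBit_and, Bool.and_eq_true, ih, hA]
      cases g u <;> simp [ht]

theorem count_eq_sum (g : ℕ → Bool) (n : ℕ) :
    count g (List.range n) = ∑ u : Fin n, if g u = true then 1 else 0 := by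
  have h : ∀ us : List ℕ, count g us = (us.map fun u => if g u = true then 1 else 0).sum := by
    intro us
    induction us with
    | nil => rfl
    | cons u us ih =>
      rw [List.map_cons, List.sum_cons, ← ih]
      change @Bool.rec (fun _ => ℕ) (count g us) (count g us + 1) (g u) = _
      cases g u <;> simp [add_comm]
  rw [h, Fin.sum_univ_eq_sum_range (fun u => if g u = true then 1 else 0) n]
  rfl

theorem count_le (g : ℕ → Bool) (n : ℕ) : count g (List.range n) ≤ n := by
  rw [count_eq_sum]
  calc _ ≤ ∑ _u : Fin n, 1 := Finset.sum_le_sum fun u _ => by split_ifs <;> simp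
    _ = n := by simp

theorem count_congr {n : ℕ} {g g' : ℕ → Bool} (e : Fin n ≃ Fin n) (h : ∀ u, g' (e u) = g u) :
    count g' (List.range n) = count g (List.range n) := by
  rw [count_eq_sum, count_eq_sum, ← Equiv.sum_comp e]
  simp only [h]

theorem lookup_map_range (g : ℕ → ℕ) (n i : ℕ) :
    lookup ((List.range n).map g) i = if i < n then g i else 0 := by
  have h : ∀ (l : List ℕ) (i : ℕ), lookup l i = l.getD i 0 := by
    intro l
    induction l with
    | nil => intro i; rfl
    | cons a l ih => intro i; cases i with
      | zero => rfl
      | succ i => rw [List.getD_cons_succ, ← ih]; rfl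
  rw [h]
  by_cases hi : i < n <;> simp [List.getD, hi]

theorem nbr_eq (p v u : ℕ) : T.nbr p v u = (decide (u ≠ v) && T.adj p u v) := by
  rw [nbr]
  by_cases h : u = v
  · simp [h]
  · simp [natBeq_eq_false h, h]

theorem testBit_lit_true (ht : t < 2 ^ m) (u v : ℕ) :
    (T.lit m u v true).testBit t = T.nbr t v u := by
  rw [Bool.eq_iff_iff, testBit_lit ht, nbr_eq]
  simp

theorem testBit_degreeMask (ht : t < 2 ^ m) (vs : List ℕ) (v d : ℕ) :
    (T.degreeMask m vs v d).testBit t = true ↔ T.degree vs t v = d :=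
  testBit_countMask ht (fun u => testBit_lit_true ht u v) vs d

theorem testBit_lowMask (ht : t < 2 ^ m) (n v : ℕ) :
    (T.lowMask m n (List.range n) v).testBit t =
      Nat.ble (Nat.add (T.degree (List.range n) t v) (T.degree (List.range n) t v)) n := by
  have h : ∀ ds : List ℕ, (ds.foldr (fun d mask =>
      cond (Nat.ble (Nat.add d d) n) (Nat.lor (T.degreeMask m (List.range n) v d) mask) mask)
      0).testBit t = true ↔ ∃ d ∈ ds, d + d ≤ n ∧ T.degree (List.range n) t v = d := by
    intro ds
    induction ds with
    | nil => simp
    | cons d ds ih =>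
      rw [List.foldr_cons, List.exists_mem_cons_iff, ← ih]
      rcases hd : Nat.ble (Nat.add d d) n with _ | _
      · have hd' : ¬ d + d ≤ n := fun h => by simp [Nat.ble_eq_true_of_le h] at hd
        simp [hd']
      · have hd' : d + d ≤ n := Nat.le_of_ble_eq_true hd
        change Nat.testBit (_ ||| _) t = true ↔ _
        rw [Nat.testBit_or, Bool.or_eq_true, testBit_degreeMask ht]
        simp [hd']
  rw [Bool.eq_iff_iff, lowMask, h, Nat.ble_eq]
  constructor
  · rintro ⟨d, _, h1, h2⟩; rw [h2]; exact h1
  · intro h1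
    exact ⟨_, List.mem_range.2 (Nat.lt_succ_of_le (count_le _ n)), h1, rfl⟩

theorem testBit_lowDegreeMask (ht : t < 2 ^ m) (n v d : ℕ) :
    (T.lowDegreeMask m n (List.range n) v d).testBit t = true ↔
      T.lowDegree n (List.range n) t v = d := by
  refine testBit_countMask ht (fun u => ?_) _ d
  change Nat.testBit (_ &&& _) t = _
  rw [Nat.testBit_and, testBit_lit_true ht, testBit_lowMask ht]
  cases T.nbr t v u <;> rfl

theorem nbr_iso {n p : ℕ} (e : T.graph n p ≃g T.graph n t) (v u : Fin n) :
    T.nbr t (e v) (e u) = T.nbr p v u := by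
  have key : ∀ (q : ℕ) (w u : Fin n), T.nbr q w u = true ↔ (T.graph n q).Adj u w := by
    intro q w u
    rw [nbr_eq]
    simp [graph, Fin.ext_iff]
  rw [Bool.eq_iff_iff, key, key]
  exact e.map_rel_iff

/-- Degrees and low degrees only prune the isomorphism search; invariance is all that its
correctness requires of them. -/
theorem degree_iso {n p : ℕ} (e : T.graph n p ≃g T.graph n t) (v : Fin n) :
    T.degree (List.range n) t (e v) = T.degree (List.range n) p v :=
  count_congr e.toEquiv fun u => nbr_iso e v u

theorem lowDegree_iso {n p : ℕ} (e : T.graph n p ≃g T.graph n t) (v : Fin n) :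
    T.lowDegree n (List.range n) t (e v) = T.lowDegree n (List.range n) p v := by
  refine count_congr e.toEquiv fun u => ?_
  have h1 : T.nbr t (e v) (e.toEquiv u) = T.nbr p v u := nbr_iso e v u
  have h2 : T.degree (List.range n) t (e.toEquiv u) = T.degree (List.range n) p u := degree_iso e u
  rw [h1, h2]

theorem testBit_nonIsomorphic {n : ℕ} {vs : List ℕ} (hvs : vs = List.range n) (ht : t < 2 ^ m)
    (p U : ℕ) :
    (T.nonIsomorphic m n vs p U).testBit t = true ↔
      U.testBit t = true ∧ ¬ Nonempty (T.graph n p ≃g T.graph n t) := by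
  subst hvs
  -- The bounds by `n` reflect the value `0` of `lookup` beyond its table; `count_le` shows that
  -- actual labels satisfy them.
  rw [nonIsomorphic, testBit_search (S := fun l v => (l.1 ≤ n ∧ T.degree (List.range n) t v = l.1) ∧
      (l.2 ≤ n ∧ T.lowDegree n (List.range n) t v = l.2))
    (fun u v b => testBit_lit ht u v b),
    extends_iff_exists_embedding rfl _ _ _ (T.graph n p) fun i j hij => by simp [graph, hij.ne]]
  · refine and_congr_right fun _ => not_congr ⟨fun ⟨φ, _⟩ => nonempty_iso_of_embedding φ, ?_⟩
    rintro ⟨e⟩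
    exact ⟨e.toEmbedding, fun i => ⟨⟨count_le _ n, degree_iso e i⟩,
      ⟨count_le _ n, lowDegree_iso e i⟩⟩⟩
  · intro l v mask
    change Nat.testBit ((mask &&& _) &&& _) t = true ↔ _
    rw [Nat.testBit_and, Nat.testBit_and, Bool.and_eq_true, Bool.and_eq_true, and_assoc]
    refine and_congr_right fun _ => and_congr ?_ ?_
    · rw [lookup_map_range]
      split_ifs with h
      · rw [testBit_degreeMask ht]; simp [Nat.lt_succ_iff.1 h]
      · simp; omega
    · rw [lookup_map_range]
      split_ifs with h
      · rw [testBit_lowDegreeMask ht]; simp [Nat.lt_succ_iff.1 h]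
      · simp; omega

theorem testBit_of_nonIsomorphic {n : ℕ} {vs : List ℕ} {p U : ℕ}
    (ht : (T.nonIsomorphic m n vs p U).testBit t = true) : U.testBit t = true := by
  refine ((testBit_search
    (S := fun l v =>
      (lookup ((List.range (n + 1)).map (T.degreeMask m vs v)) l.1).testBit t = true ∧
      (lookup ((List.range (n + 1)).map (T.lowDegreeMask m n vs v)) l.2).testBit t = true)
    (R := fun u v b => (T.lit m u v b).testBit t = true)
    (fun _ _ _ => Iff.rfl) (fun l v mask => ?_) _ _ _ _).1 ht).1
  change Nat.testBit ((mask &&& _) &&& _) t = true ↔ _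
  rw [Nat.testBit_and, Nat.testBit_and, Bool.and_eq_true, Bool.and_eq_true, and_assoc]

theorem lt_two_pow_of_testBit {U : ℕ} (hU : ∀ t, U.testBit t = true → t < 2 ^ m) :
    U < 2 ^ 2 ^ m :=
  Nat.lt_pow_two_of_testBit U fun t ht => Bool.eq_false_iff.2 fun h => (hU t h).not_ge ht

theorem mem_classes {n : ℕ} {vs : List ℕ} {fuel U p : ℕ}
    (hU : ∀ t, U.testBit t = true → t < 2 ^ m) (hp : p ∈ T.classes m n vs fuel U) :
    U.testBit p = true := by
  induction fuel generalizing U with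
  | zero => simp [classes] at hp
  | succ fuel ih =>
    rw [classes] at hp
    by_cases h : U = 0
    · subst h; simp at hp
    · simp only [natBeq_eq_false h, cond_false, List.mem_cons] at hp
      rcases hp with rfl | hp
      · exact (someBit_spec h (lt_two_pow_of_testBit hU)).2
      · exact testBit_of_nonIsomorphic (ih (fun t ht => hU t (testBit_of_nonIsomorphic ht)) hp)

theorem pairwise_classes {n : ℕ} {vs : List ℕ} (hvs : vs = List.range n) {fuel U : ℕ}
    (hU : ∀ t, U.testBit t = true → t < 2 ^ m) :
    (T.classes m n vs fuel U).Pairwise fun p q => ¬ Nonempty (T.graph n p ≃g T.graph n q) := by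
  induction fuel generalizing U with
  | zero => simp [classes]
  | succ fuel ih =>
    rw [classes]
    by_cases h : U = 0
    · subst h; simp
    · simp only [natBeq_eq_false h, cond_false, List.pairwise_cons]
      have hU' : ∀ t, (T.nonIsomorphic m n vs (someBit m U) U).testBit t = true → t < 2 ^ m :=
        fun t ht => hU t (testBit_of_nonIsomorphic ht)
      refine ⟨fun q hq => ?_, ih hU'⟩
      have hq' := mem_classes hU' hq
      exact ((testBit_nonIsomorphic hvs (hU' q hq') _ _).1 hq').2

/-- A list shorter than the fuel ended because the set became empty, so every member was deleted by
some representative. -/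
theorem exists_mem_classes {n : ℕ} {vs : List ℕ} (hvs : vs = List.range n) {fuel U : ℕ}
    (hU : ∀ t, U.testBit t = true → t < 2 ^ m) (hlen : (T.classes m n vs fuel U).length < fuel)
    (ht : U.testBit t = true) :
    ∃ p ∈ T.classes m n vs fuel U, Nonempty (T.graph n p ≃g T.graph n t) := by
  induction fuel generalizing U with
  | zero => simp at hlen
  | succ fuel ih =>
    rw [classes] at hlen ⊢
    by_cases h : U = 0
    · subst h; simp at ht
    · simp only [natBeq_eq_false h, cond_false, List.length_cons, add_lt_add_iff_right] at hlen ⊢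
      by_cases hiso : Nonempty (T.graph n (someBit m U) ≃g T.graph n t)
      · exact ⟨_, List.mem_cons_self, hiso⟩
      · have hU' : ∀ t, (T.nonIsomorphic m n vs (someBit m U) U).testBit t = true → t < 2 ^ m :=
          fun t ht => hU t (testBit_of_nonIsomorphic ht)
        obtain ⟨p, hp, hp'⟩ := ih hU' hlen
          ((testBit_nonIsomorphic hvs (hU t ht) _ _).2 ⟨ht, hiso⟩)
        exact ⟨p, List.mem_cons_of_mem _ hp, hp'⟩

/-! ### Symmetry breaking -/

variable (T : Pattern)

/-- The pairs `(i, j)` with `i < j < n`. -/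
def pairs (n : ℕ) : List (ℕ × ℕ) :=
  (List.range n).flatMap fun j => (List.range j).map fun i => (i, j)

/-- The adjacencies of a list of pairs, read as a binary number. -/
def key (h : ℕ → ℕ → Bool) : List (ℕ × ℕ) → ℕ
  | [] => 0
  | e :: es => 2 ^ es.length * (h e.1 e.2).toNat + key h es

/-- The parameters of the graphs whose `key` does not become smaller when the vertices are
permuted by `s`. -/
def keyMask (m : ℕ) (s : ℕ → ℕ) : List (ℕ × ℕ) → ℕ
  | [] => full m
  | e :: es =>
    (fun x y => Nat.lor (Nat.land (Nat.xor (full m) x) y)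
      (Nat.land (Nat.xor (full m) (Nat.xor x y)) (keyMask m s es)))
      (T.mask m e.1 e.2) (T.mask m (s e.1) (s e.2))

/-- The parameters of the graphs whose `key` is minimal with respect to the permutations `syms`. -/
def minimalMask (n m : ℕ) : List (List ℕ) → ℕ
  | [] => full m
  | s :: syms => Nat.land (T.keyMask m (lookup s) (pairs n)) (minimalMask n m syms)

/-- `s` permutes the vertices and respects the prescribed entries of the pattern. -/
def IsSymmetry (n : ℕ) (s : ℕ → ℕ) : Prop :=
  (∀ j < n, s j < n) ∧ ∀ j < n, ∀ i < j,
    s i ≠ s j ∧ (T.cell i j < 2 → T.cell (s i) (s j) = T.cell i j)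

instance (n : ℕ) (s : ℕ → ℕ) : Decidable (T.IsSymmetry n s) := by
  unfold IsSymmetry; infer_instance

variable {T} {m n t : ℕ}

/-- By this bound the leading pair dominates all later ones, so keys compare lexicographically. -/
theorem key_lt (h : ℕ → ℕ → Bool) (es : List (ℕ × ℕ)) : key h es < 2 ^ es.length := by
  induction es with
  | nil => simp [key]
  | cons e es ih =>
    rw [key, List.length_cons, pow_succ]
    cases h e.1 e.2 <;> simp <;> omega

theorem testBit_keyMask (ht : t < 2 ^ m) (s : ℕ → ℕ) (es : List (ℕ × ℕ)) :
    (T.keyMask m s es).testBit t = true ↔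
      key (T.adj t) es ≤ key (fun i j => T.adj t (s i) (s j)) es := by
  induction es with
  | nil => simp [keyMask, key, testBit_full, ht]
  | cons e es ih =>
    rw [keyMask]
    change Nat.testBit ((full m ^^^ T.mask m e.1 e.2) &&& T.mask m (s e.1) (s e.2) |||
      (full m ^^^ (T.mask m e.1 e.2 ^^^ T.mask m (s e.1) (s e.2))) &&&
        T.keyMask m s es) t = true ↔ _
    simp only [Nat.testBit_or, Nat.testBit_and, Nat.testBit_xor, testBit_full, ht,
      testBit_mask ht, Bool.or_eq_true, Bool.and_eq_true, ih, key]
    have h1 := key_lt (T.adj t) es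
    have h2 := key_lt (fun i j => T.adj t (s i) (s j)) es
    cases T.adj t e.1 e.2 <;> cases T.adj t (s e.1) (s e.2) <;> simp <;> omega

theorem key_congr {h h' : ℕ → ℕ → Bool} {es : List (ℕ × ℕ)}
    (H : ∀ e ∈ es, h e.1 e.2 = h' e.1 e.2) : key h es = key h' es := by
  induction es with
  | nil => rfl
  | cons e es ih =>
    rw [List.forall_mem_cons] at H
    rw [key, key, H.1, ih H.2]

theorem mem_pairs {e : ℕ × ℕ} : e ∈ pairs n ↔ e.1 < e.2 ∧ e.2 < n := by
  obtain ⟨i, j⟩ := e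
  simp only [pairs, List.mem_flatMap, List.mem_range, List.mem_map, Prod.mk.injEq]
  constructor
  · rintro ⟨_, h1, _, h2, rfl, rfl⟩; exact ⟨h2, h1⟩
  · rintro ⟨h1, h2⟩; exact ⟨j, h2, i, h1, rfl, rfl⟩

theorem adj_congr_of_graph_eq {p q : ℕ} {f : Fin n ≃ Fin n}
    (h : T.graph n q = (T.graph n p).comap f) {i j : Fin n} (hij : i ≠ j) :
    T.adj q i j = T.adj p (f i) (f j) := by
  have h1 : (T.graph n q).Adj i j ↔ (T.graph n p).Adj (f i) (f j) := by rw [h]; rfl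
  have h2 : f i ≠ f j := fun e => hij (f.injective e)
  simpa [graph, hij, h2, ← Bool.eq_iff_iff] using h1

theorem testBit_minimalMask (ht : t < 2 ^ m) {syms : List (List ℕ)} :
    (T.minimalMask n m syms).testBit t = true ↔
      ∀ s ∈ syms, (T.keyMask m (lookup s) (pairs n)).testBit t = true := by
  induction syms with
  | nil => simp [minimalMask, testBit_full, ht]
  | cons s syms ih =>
    rw [minimalMask]
    change Nat.testBit (_ &&& _) t = true ↔ _
    rw [Nat.testBit_and, Bool.and_eq_true, ih, List.forall_mem_cons]

theorem lt_of_testBit_minimalMask {syms : List (List ℕ)}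
    (h : (T.minimalMask n m syms).testBit t = true) : t < 2 ^ m := by
  induction syms with
  | nil => simpa [minimalMask, testBit_full] using h
  | cons s syms ih =>
    rw [minimalMask] at h
    change Nat.testBit (_ &&& _) t = true at h
    rw [Nat.testBit_and, Bool.and_eq_true] at h
    exact ih h.2

/-- Among the isomorphic members of a family one has minimal key. -/
theorem exists_minimal (hT : T.Valid n m) {syms : List (List ℕ)}
    (hsyms : ∀ s ∈ syms, T.IsSymmetry n (lookup s)) {p₀ : ℕ} (hp₀ : p₀ < 2 ^ m) :
    ∃ p, (T.minimalMask n m syms).testBit p = true ∧ Nonempty (T.graph n p ≃g T.graph n p₀) := by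
  classical
  let C : Finset ℕ := (Finset.range (2 ^ m)).filter fun p => Nonempty (T.graph n p ≃g T.graph n p₀)
  have hC : C.Nonempty := ⟨p₀, Finset.mem_filter.2
    ⟨Finset.mem_range.2 hp₀, ⟨SimpleGraph.Iso.refl⟩⟩⟩
  -- A minimum over all isomorphic members passes the test for every symmetry at once. Several
  -- members of a class may pass; `classes` removes such duplicates.
  obtain ⟨p, hp, hmin⟩ := Finset.exists_min_image C (fun p => key (T.adj p) (pairs n)) hC
  obtain ⟨hpm, ⟨e⟩⟩ := Finset.mem_filter.1 hp
  rw [Finset.mem_range] at hpm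
  refine ⟨p, (testBit_minimalMask hpm).2 fun s hs => (testBit_keyMask hpm _ _).2 ?_, ⟨e⟩⟩
  obtain ⟨h1, h2⟩ := hsyms s hs
  let f₀ : Fin n → Fin n := fun i => ⟨lookup s i, h1 i i.2⟩
  have hf₀ : Function.Injective f₀ := by
    intro i j hij
    by_contra hne
    rcases lt_or_gt_of_ne hne with h | h
    · exact (h2 j j.2 i h).1 (Fin.mk.inj hij)
    · exact (h2 i i.2 j h).1 (Fin.mk.inj hij).symm
  let f : Fin n ≃ Fin n := Equiv.ofBijective f₀ (Finite.injective_iff_bijective.1 hf₀)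
  -- Since `s` respects the prescribed entries, the permuted graph is again a member of the family
  -- and competes for the minimum.
  obtain ⟨q, hq, hgq⟩ := exists_graph_eq hT ((T.graph n p).comap f) (by
    intro i j hij
    obtain ⟨hne, hcell⟩ := h2 j j.2 i hij
    have hadj : ((T.graph n p).comap f).Adj i j ↔
        T.adj p (lookup s i) (lookup s j) = true :=
      and_iff_right fun e => hne (Fin.ext_iff.1 e)
    rw [hadj]
    constructor <;> intro hc
    · have := hcell (by omega)
      rw [hc] at this
      simp [adj, this]
    · have := hcell (by omega)
      rw [hc] at this
      simp [adj, this])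
  have hqC : q ∈ C := by
    refine Finset.mem_filter.2 ⟨Finset.mem_range.2 hq, ⟨?_⟩⟩
    rw [hgq]
    exact (SimpleGraph.Iso.comap f (T.graph n p)).trans e
  refine (hmin q hqC).trans_eq (key_congr fun e he => ?_)
  obtain ⟨h3, h4⟩ := mem_pairs.1 he
  exact adj_congr_of_graph_eq (f := f) hgq (i := ⟨e.1, h3.trans h4⟩) (j := ⟨e.2, h4⟩)
    fun h => h3.ne (Fin.mk.inj h)

/-! ### Counting universal graphs -/

/-- Universality can be tested on the graphs `hs`, if every graph on `k` vertices contains one of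
them. -/
theorem isInducedUniversal_iff {P : Pattern} {k l : ℕ} {ks hs : List ℕ} (hks : ks = List.range k)
    (hP : P.Valid k l) (hP' : ∀ j < k, ∀ i < j, 2 ≤ P.cell i j)
    (hhs : P.avoidingAll l ks P k hs (full l) = 0) (G : SimpleGraph (Fin n)) :
    IsInducedUniversal (allGraphs k) G ↔ ∀ h ∈ hs, Nonempty (P.graph k h ↪g G) := by
  refine ⟨fun hG h _ => hG _ (Set.mem_univ _), fun hG H _ => ?_⟩
  obtain ⟨p, hp, rfl⟩ := exists_graph_eq hP H fun i j hij => by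
    have := hP' j j.2 i hij
    constructor <;> intro <;> omega
  have h0 : (P.avoidingAll l ks P k hs (full l)).testBit p ≠ true := by simp [hhs]
  rw [Ne, testBit_avoidingAll hks hp] at h0
  simp only [testBit_full, hp, decide_true, true_and, not_forall, not_not] at h0
  obtain ⟨h, hh, ⟨φ⟩⟩ := h0
  obtain ⟨e⟩ := nonempty_iso_of_embedding φ
  exact (hG h hh).map fun ψ => e.symm.toEmbedding.trans ψ

variable (T)

/-- Parameters of the induced universal graphs for the graphs on `k` vertices, up to
isomorphism. -/
def universalClasses (n m : ℕ) (vs : List ℕ) (syms : List (List ℕ)) (P : Pattern) (k : ℕ)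
    (hs : List ℕ) (fuel : ℕ) : List ℕ :=
  T.classes m n vs fuel (T.containingAll m vs P k hs (T.minimalMask n m syms))

variable {T}

/-- If every universal graph of order `n` is isomorphic to a member of the family, the
isomorphism classes of the universal graphs can be counted within the family. -/
theorem card_quotient {P : Pattern} {k l : ℕ} {ks vs hs : List ℕ} {syms : List (List ℕ)} {c : ℕ}
    (hks : ks = List.range k) (hP : P.Valid k l) (hP' : ∀ j < k, ∀ i < j, 2 ≤ P.cell i j)
    (hhs : P.avoidingAll l ks P k hs (full l) = 0)
    (hvs : vs = List.range n) (hT : T.Valid n m)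
    (hsyms : ∀ s ∈ syms, T.IsSymmetry n (lookup s))
    (hfam : ∀ G : SimpleGraph (Fin n), IsInducedUniversal (allGraphs k) G →
      ∃ p < 2 ^ m, Nonempty (T.graph n p ≃g G))
    (hc : (T.universalClasses n m vs syms P k hs (c + 1)).length = c) :
    Nat.card (Quotient (isoSetoid k n)) = c := by
  have huniv := isInducedUniversal_iff (n := n) hks hP hP' hhs
  set L := T.universalClasses n m vs syms P k hs (c + 1) with hL
  have hU : ∀ t, (T.containingAll m vs P k hs (T.minimalMask n m syms)).testBit t = true →
      t < 2 ^ m := fun t ht => lt_of_testBit_minimalMask (testBit_of_containingAll ht)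
  have hmem : ∀ p ∈ L, IsInducedUniversal (allGraphs k) (T.graph n p) := fun p hp => by
    have h1 := mem_classes hU hp
    exact (huniv _).2 ((testBit_containingAll hvs (hU p h1) _ _ _ _).1 h1).2
  have hpair := pairwise_classes (T := T) (fuel := c + 1) hvs hU
  let Φ : Fin L.length → Quotient (isoSetoid k n) := fun i =>
    Quotient.mk _ ⟨T.graph n (L.get i), hmem _ (List.get_mem L i)⟩
  have hΦ : Function.Bijective Φ := by
    constructor
    · intro i j hij
      have hiso : Nonempty (T.graph n (L.get i) ≃g T.graph n (L.get j)) := Quotient.exact hij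
      by_contra hne
      rcases lt_or_gt_of_ne hne with h | h
      · exact List.pairwise_iff_get.1 hpair i j h hiso
      · exact List.pairwise_iff_get.1 hpair j i h (hiso.map fun e => e.symm)
    · intro q
      induction q using Quotient.inductionOn with
      | h G =>
        obtain ⟨G, hG⟩ := G
        obtain ⟨p₀, hp₀, ⟨e₀⟩⟩ := hfam G hG
        obtain ⟨t, ht, ⟨e₁⟩⟩ := exists_minimal hT hsyms hp₀
        have htU : (T.containingAll m vs P k hs (T.minimalMask n m syms)).testBit t = true :=
          (testBit_containingAll hvs (lt_of_testBit_minimalMask ht) _ _ _ _).2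
            ⟨ht, (huniv _).1 (hG.of_iso (e₁.trans e₀).symm)⟩
        -- Fuel `c + 1` against length `c` certifies that the list is exhaustive.
        obtain ⟨p, hp, ⟨e₂⟩⟩ := exists_mem_classes (fuel := c + 1) hvs hU (by
          change L.length < c + 1
          omega) htU
        obtain ⟨i, hi⟩ := List.get_of_mem hp
        refine ⟨i, Quotient.sound ⟨?_⟩⟩
        change T.graph n (L.get i) ≃g G
        rw [show L.get i = p from hi]
        exact (e₂.trans e₁).trans e₀
  rw [← Nat.card_congr (Equiv.ofBijective Φ hΦ), Nat.card_fin, hc]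

end Pattern

/-! ### The structure of universal graphs -/

section Structure

variable {k : ℕ} {V : Type*} {G : SimpleGraph V}

/-- A complete and an edgeless subgraph of order `k` share at most one vertex. -/
theorem IsInducedUniversal.exists_clique_indep [DecidableEq V]
    (hG : IsInducedUniversal (allGraphs k) G) :
    ∃ K I : Finset V, K.card = k ∧ I.card = k ∧ (∀ u ∈ K, ∀ v ∈ K, u ≠ v → G.Adj u v) ∧
      (∀ u ∈ I, ∀ v ∈ I, ¬ G.Adj u v) ∧ (K ∩ I).card ≤ 1 := by
  obtain ⟨φ⟩ := hG ⊤ (Set.mem_univ _)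
  obtain ⟨ψ⟩ := hG ⊥ (Set.mem_univ _)
  have hK : ∀ u ∈ Finset.univ.map φ.toEmbedding, ∀ v ∈ Finset.univ.map φ.toEmbedding,
      u ≠ v → G.Adj u v := by
    simp only [Finset.mem_map, Finset.mem_univ, true_and]
    rintro _ ⟨i, rfl⟩ _ ⟨j, rfl⟩ h
    exact φ.map_rel_iff.2 fun e => h (by rw [e])
  have hI : ∀ u ∈ Finset.univ.map ψ.toEmbedding, ∀ v ∈ Finset.univ.map ψ.toEmbedding,
      ¬ G.Adj u v := by
    simp only [Finset.mem_map, Finset.mem_univ, true_and]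
    rintro _ ⟨i, rfl⟩ _ ⟨j, rfl⟩ h
    exact ψ.map_rel_iff.1 h
  refine ⟨_, _, by simp, by simp, hK, hI, Finset.card_le_one.2 fun u hu v hv => ?_⟩
  rw [Finset.mem_inter] at hu hv
  by_contra hne
  exact hI u hu.2 v hv.2 (hK u hu.1 v hv.1 hne)

variable [Fintype V] [DecidableEq V] {K I : Finset V}

theorem two_mul_le_card_add_one (hK : K.card = k) (hI : I.card = k) (hKI : (K ∩ I).card ≤ 1) :
    2 * k ≤ Fintype.card V + 1 := by
  have h1 := Finset.card_union_add_card_inter K I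
  have h2 := Finset.card_le_univ (K ∪ I)
  omega

theorem two_mul_le_card (hK : K.card = k) (hI : I.card = k) (hKI : (K ∩ I).card ≤ 1) {x : V}
    (hxK : x ∉ K) (hxI : x ∉ I) : 2 * k ≤ Fintype.card V := by
  have h1 := Finset.card_union_add_card_inter K I
  have h2 := Finset.card_le_univ (insert x (K ∪ I))
  rw [Finset.card_insert_of_notMem (by simp [hxK, hxI])] at h2
  omega

/-- Disjoint `K` and `I` together with `x` would occupy `2 * k + 1` vertices. -/
theorem exists_inter_eq_singleton (hK : K.card = k) (hI : I.card = k) (hKI : (K ∩ I).card ≤ 1)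
    {x : V} (hxK : x ∉ K) (hxI : x ∉ I) (hV : Fintype.card V = 2 * k) : ∃ c, K ∩ I = {c} := by
  have h1 := Finset.card_union_add_card_inter K I
  have h2 := Finset.card_le_univ (insert x (K ∪ I))
  rw [Finset.card_insert_of_notMem (by simp [hxK, hxI])] at h2
  exact Finset.card_eq_one.1 (by omega)

end Structure

/-! ### Cycles against a clique and an independent set -/

section Cycles

open SimpleGraph (cycleGraph)

variable {V : Type*} {G : SimpleGraph V} {K I : Finset V}

theorem notMem_indep_of_adj {k : ℕ} {H : SimpleGraph (Fin k)} (hI : ∀ u ∈ I, ∀ v ∈ I, ¬ G.Adj u v)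
    (φ : H ↪g G) {i j : Fin k} (h : H.Adj i j) : φ i ∉ I ∨ φ j ∉ I := by
  by_contra! h'
  exact hI _ h'.1 _ h'.2 (φ.map_rel_iff.2 h)

theorem notMem_clique_of_not_adj {k : ℕ} {H : SimpleGraph (Fin k)}
    (hK : ∀ u ∈ K, ∀ v ∈ K, u ≠ v → G.Adj u v) (φ : H ↪g G) {i j : Fin k} (hne : i ≠ j)
    (h : ¬ H.Adj i j) : φ i ∉ K ∨ φ j ∉ K := by
  by_contra! h'
  exact h (φ.map_rel_iff.1 (hK _ h'.1 _ h'.2 (φ.injective.ne hne)))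

/-- A `4`-cycle is not covered by a clique and an independent set. -/
theorem exists_notMem_of_four_cycle (hK : ∀ u ∈ K, ∀ v ∈ K, u ≠ v → G.Adj u v)
    (hI : ∀ u ∈ I, ∀ v ∈ I, ¬ G.Adj u v) (φ : cycleGraph 4 ↪g G) :
    ∃ i, φ i ∉ K ∧ φ i ∉ I := by
  by_contra! hcov
  have hadj : ∀ i : Fin 4, (cycleGraph 4).Adj i (i + 1) ∧ (cycleGraph 4).Adj (i + 3) i := by decide
  have hnadj : ∀ i : Fin 4, i ≠ i + 2 ∧ ¬ (cycleGraph 4).Adj i (i + 2) := by decide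
  -- A cycle vertex in `K` sends its opposite to `I`, hence both neighbours to `K`, although these
  -- are not adjacent. So all four vertices lie in `I`, which contradicts any edge.
  have hnK : ∀ i, φ i ∉ K := fun i hi => by
    have h2 : φ (i + 2) ∈ I := hcov _
      ((notMem_clique_of_not_adj hK φ (hnadj i).1 (hnadj i).2).resolve_left (not_not.2 hi))
    have h1 : φ (i + 2 + 1) ∈ K := not_not.1 fun h =>
      (notMem_indep_of_adj hI φ (hadj (i + 2)).1).elim (fun h' => h' h2) fun h' => h' (hcov _ h)
    have h3 : φ (i + 2 + 3) ∈ K := not_not.1 fun h =>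
      (notMem_indep_of_adj hI φ (hadj (i + 2)).2).elim (fun h' => h' (hcov _ h)) fun h' => h' h2
    have h13 : ∀ i : Fin 4, i + 2 + 1 ≠ i + 2 + 3 ∧
      ¬ (cycleGraph 4).Adj (i + 2 + 1) (i + 2 + 3) := by decide
    exact (notMem_clique_of_not_adj hK φ (h13 i).1 (h13 i).2).elim (fun h => h h1) fun h => h h3
  exact (notMem_indep_of_adj hI φ (hadj 0).1).elim (fun h => h (hcov _ (hnK _)))
    fun h => h (hcov _ (hnK _))

/-- A `5`-cycle is not covered by a clique and an independent set. -/
theorem exists_notMem_of_five_cycle (hK : ∀ u ∈ K, ∀ v ∈ K, u ≠ v → G.Adj u v)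
    (hI : ∀ u ∈ I, ∀ v ∈ I, ¬ G.Adj u v) (φ : cycleGraph 5 ↪g G) :
    ∃ i, φ i ∉ K ∧ φ i ∉ I := by
  by_contra! hcov
  have hadj : ∀ i : Fin 5, (cycleGraph 5).Adj i (i + 1) ∧ (cycleGraph 5).Adj (i + 2) (i + 3) := by
    decide
  have hnadj : ∀ i : Fin 5, (i ≠ i + 2 ∧ ¬ (cycleGraph 5).Adj i (i + 2)) ∧
      i ≠ i + 3 ∧ ¬ (cycleGraph 5).Adj i (i + 3) := by decide
  -- The two non-neighbours of a cycle vertex in `K` would both lie in `I`, but they are adjacent.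
  have hnK : ∀ i, φ i ∉ K := fun i hi => by
    have h2 := (notMem_clique_of_not_adj hK φ (hnadj i).1.1 (hnadj i).1.2).resolve_left
      (not_not.2 hi)
    have h3 := (notMem_clique_of_not_adj hK φ (hnadj i).2.1 (hnadj i).2.2).resolve_left
      (not_not.2 hi)
    exact (notMem_indep_of_adj hI φ (hadj i).2).elim (fun h => h (hcov _ h2))
      fun h => h (hcov _ h3)
  exact (notMem_indep_of_adj hI φ (hadj 0).1).elim (fun h => h (hcov _ (hnK _)))
    fun h => h (hcov _ (hnK _))

/-- The position of a `5`-cycle in a graph that is covered by a clique, an independent set and one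
further vertex. -/
theorem exists_path_of_five_cycle (hK : ∀ u ∈ K, ∀ v ∈ K, u ≠ v → G.Adj u v)
    (hI : ∀ u ∈ I, ∀ v ∈ I, ¬ G.Adj u v) {x : V} (hx : ∀ v, v ∉ K → v ∉ I → v = x)
    (φ : cycleGraph 5 ↪g G) :
    ∃ a₁ a₂ b₁ b₂, (a₁ ∈ K ∧ a₁ ∉ I) ∧ (a₂ ∈ K ∧ a₂ ∉ I) ∧ (b₁ ∈ I ∧ b₁ ∉ K) ∧ (b₂ ∈ I ∧ b₂ ∉ K) ∧
      (G.Adj a₁ b₁ ∧ G.Adj a₂ b₂ ∧ ¬ G.Adj a₁ b₂ ∧ ¬ G.Adj a₂ b₁) ∧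
      (G.Adj x b₁ ∧ G.Adj x b₂ ∧ ¬ G.Adj x a₁ ∧ ¬ G.Adj x a₂) := by
  obtain ⟨i, hiK, hiI⟩ := exists_notMem_of_five_cycle hK hI φ
  have hi := hx _ hiK hiI
  have hrot : ∀ i j l : Fin 5, (cycleGraph 5).Adj (i + j) (i + l) ↔ (cycleGraph 5).Adj j l := by
    decide
  -- The cycle is rotated so that it starts at `x`.
  let ψ : cycleGraph 5 ↪g G :=
    ⟨⟨fun j => φ (i + j), fun j l h => add_left_cancel (φ.injective h)⟩,
      fun {j l} => φ.map_rel_iff.trans (hrot i j l)⟩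
  have hψ : ψ 0 = x := by rw [← hi]; exact congrArg φ (add_zero i)
  have hcov : ∀ j : Fin 5, j ≠ 0 → ψ j ∉ K → ψ j ∈ I := fun j hj hjK => by
    by_contra hjI
    exact hj (ψ.injective ((hx _ hjK hjI).trans hψ.symm))
  have h12 := notMem_indep_of_adj hI ψ (i := 1) (j := 2) (by decide)
  have h34 := notMem_indep_of_adj hI ψ (i := 3) (j := 4) (by decide)
  have h13 := notMem_clique_of_not_adj hK ψ (i := 1) (j := 3) (by decide) (by decide)
  have h14 := notMem_clique_of_not_adj hK ψ (i := 1) (j := 4) (by decide) (by decide)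
  have h24 := notMem_clique_of_not_adj hK ψ (i := 2) (j := 4) (by decide) (by decide)
  have h1 := hcov 1 (by decide)
  have h2 := hcov 2 (by decide)
  have h3 := hcov 3 (by decide)
  have h4 := hcov 4 (by decide)
  have hadj : ∀ j l : Fin 5, G.Adj (ψ j) (ψ l) ↔ (cycleGraph 5).Adj j l := fun j l =>
    ψ.map_rel_iff
  rw [← hψ]
  -- If `ψ 1` were in `K`, the adjacent vertices `ψ 3` and `ψ 4` would both be in `I`. From `ψ 1 ∈
  -- I` the remaining positions follow one by one.
  have k1 : ψ 1 ∉ K := fun h => h34.elim (fun h' => h' (h3 (h13.resolve_left (not_not.2 h))))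
    fun h' => h' (h4 (h14.resolve_left (not_not.2 h)))
  have i1 := h1 k1
  have i2 : ψ 2 ∉ I := h12.resolve_left (not_not.2 i1)
  have k2 : ψ 2 ∈ K := not_not.1 fun h => i2 (h2 h)
  have k4 : ψ 4 ∉ K := h24.resolve_left (not_not.2 k2)
  have i4 := h4 k4
  have i3 : ψ 3 ∉ I := h34.resolve_right (not_not.2 i4)
  have k3 : ψ 3 ∈ K := not_not.1 fun h => i3 (h3 h)
  refine ⟨ψ 2, ψ 3, ψ 1, ψ 4, ⟨k2, i2⟩, ⟨k3, i3⟩, ⟨i1, k1⟩, ⟨i4, k4⟩, ?_, ?_⟩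
  · simp only [hadj]; decide
  · simp only [hadj]; decide

end Cycles

/-! ### The families that contain all candidates -/

namespace Pattern

/-- All graphs on `k ≤ 5` vertices. -/
def complete : Pattern := [[], [2], [3, 4], [5, 6, 7], [8, 9, 10, 11]]

/-- Graphs on eight vertices that consist of a vertex, another vertex `c`, and three further
vertices in each of a clique and an independent set that share `c`. -/
def eight : Pattern :=
  [[], [2], [3, 1], [4, 1, 1], [5, 1, 1, 1], [6, 0, 7, 8, 9], [10, 0, 11, 12, 13, 0],
    [14, 0, 15, 16, 17, 0, 0]]

/-- Graphs on ten vertices that consist of a vertex, another vertex `c`, and four further vertices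
in each of a clique and an independent set that share `c`, with a `5`-cycle `0, 6, 2, 3, 7`. -/
def ten : Pattern :=
  [[], [2], [0, 1], [0, 1, 1], [3, 1, 1, 1], [4, 1, 1, 1, 1], [1, 0, 1, 0, 5, 6],
    [1, 0, 0, 1, 7, 8, 0], [9, 0, 10, 11, 12, 13, 0, 0], [14, 0, 15, 16, 17, 18, 0, 0, 0]]

/-! ### Placing the universal graphs of order 8 and 10 in the families -/

theorem exists_iso_of_equiv {T : Pattern} {n m : ℕ} {V : Type*} {G : SimpleGraph V}
    (hT : T.Valid n m) (φ : Fin n ≃ V)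
    (hφ : ∀ i j : Fin n, i < j →
      (T.cell i j = 0 → ¬ G.Adj (φ i) (φ j)) ∧ (T.cell i j = 1 → G.Adj (φ i) (φ j))) :
    ∃ p < 2 ^ m, Nonempty (T.graph n p ≃g G) := by
  obtain ⟨p, hp, h⟩ := exists_graph_eq hT (G.comap φ) hφ
  exact ⟨p, hp, ⟨by rw [h]; exact SimpleGraph.Iso.comap φ G⟩⟩

theorem exists_iso_of_list {T : Pattern} {n m : ℕ} {V : Type*} [Fintype V] {G : SimpleGraph V}
    (hT : T.Valid n m) (hV : Fintype.card V = n) (l : Fin n → V) (hl : (List.ofFn l).Nodup)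
    (hadj : ∀ i j : Fin n, i < j →
      (T.cell i j = 0 → ¬ G.Adj (l i) (l j)) ∧ (T.cell i j = 1 → G.Adj (l i) (l j))) :
    ∃ p < 2 ^ m, Nonempty (T.graph n p ≃g G) :=
  exists_iso_of_equiv hT (Equiv.ofBijective l ((Fintype.bijective_iff_injective_and_card l).2
    ⟨List.nodup_ofFn.1 hl, by simp [hV]⟩)) hadj

theorem exists_iso_eight {G : SimpleGraph (Fin 8)} (hG : IsInducedUniversal (allGraphs 4) G) :
    ∃ p < 2 ^ 16, Nonempty (eight.graph 8 p ≃g G) := by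
  obtain ⟨K, I, hKc, hIc, hK, hI, hKI⟩ := hG.exists_clique_indep
  obtain ⟨φ⟩ := hG (SimpleGraph.cycleGraph 4) (Set.mem_univ _)
  obtain ⟨i, hxK, hxI⟩ := exists_notMem_of_four_cycle hK hI φ
  generalize φ i = x at hxK hxI
  obtain ⟨c, hc⟩ := exists_inter_eq_singleton hKc hIc hKI hxK hxI rfl
  have hmem : ∀ v, v ∈ K ∧ v ∈ I ↔ v = c := fun v => by
    rw [← Finset.mem_inter, hc, Finset.mem_singleton]
  obtain ⟨hcK, hcI⟩ := (hmem c).2 rfl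
  obtain ⟨a₁, a₂, a₃, h12, h13, h23, hA⟩ := Finset.card_eq_three.1
    ((Finset.card_erase_of_mem hcK).trans (by rw [hKc]))
  obtain ⟨b₁, b₂, b₃, g12, g13, g23, hB⟩ := Finset.card_eq_three.1
    ((Finset.card_erase_of_mem hcI).trans (by rw [hIc]))
  have hA' : ∀ v, v ∈ ({a₁, a₂, a₃} : Finset (Fin 8)) → v ≠ c ∧ v ∈ K := fun v hv => by
    rwa [← hA, Finset.mem_erase] at hv
  have hB' : ∀ v, v ∈ ({b₁, b₂, b₃} : Finset (Fin 8)) → v ≠ c ∧ v ∈ I := fun v hv => by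
    rwa [← hB, Finset.mem_erase] at hv
  simp only [Finset.mem_insert, Finset.mem_singleton, forall_eq_or_imp, forall_eq] at hA' hB'
  -- An `aᵢ` equal to a `bⱼ` would lie in both sets and thus be `c`, while `x` lies in neither.
  have hnodup : (List.ofFn ![x, c, a₁, a₂, a₃, b₁, b₂, b₃]).Nodup := by
    clear hK hI hc hA hB hKI hKc hIc hG
    simp only [List.ofFn_succ, List.ofFn_zero, List.nodup_cons, List.mem_cons, List.not_mem_nil,
      Matrix.cons_val_zero, Matrix.cons_val_succ, or_false, not_or, not_false_iff, List.nodup_nil,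
      and_true]
    and_intros <;> grind
  have hcell : ∀ i j : Fin 8, i < j →
      (eight.cell i j = 0 → i ∈ ({1, 5, 6, 7} : Finset (Fin 8)) ∧
        j ∈ ({1, 5, 6, 7} : Finset (Fin 8))) ∧
      (eight.cell i j = 1 → i ∈ ({1, 2, 3, 4} : Finset (Fin 8)) ∧
        j ∈ ({1, 2, 3, 4} : Finset (Fin 8))) := by
    decide
  have hKl : ∀ i ∈ ({1, 2, 3, 4} : Finset (Fin 8)), ![x, c, a₁, a₂, a₃, b₁, b₂, b₃] i ∈ K := by
    simp [hcK, hA']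
  have hIl : ∀ i ∈ ({1, 5, 6, 7} : Finset (Fin 8)), ![x, c, a₁, a₂, a₃, b₁, b₂, b₃] i ∈ I := by
    simp [hcI, hB']
  refine exists_iso_of_list (by decide +kernel) (by simp) _ hnodup fun i j hij =>
    ⟨fun h => ?_, fun h => ?_⟩
  · obtain ⟨hi, hj⟩ := (hcell i j hij).1 h
    exact hI _ (hIl i hi) _ (hIl j hj)
  · obtain ⟨hi, hj⟩ := (hcell i j hij).2 h
    exact hK _ (hKl i hi) _ (hKl j hj) fun e => hij.ne (List.nodup_ofFn.1 hnodup e)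

theorem exists_iso_ten {G : SimpleGraph (Fin 10)} (hG : IsInducedUniversal (allGraphs 5) G) :
    ∃ p < 2 ^ 17, Nonempty (ten.graph 10 p ≃g G) := by
  obtain ⟨K, I, hKc, hIc, hK, hI, hKI⟩ := hG.exists_clique_indep
  obtain ⟨φ⟩ := hG (SimpleGraph.cycleGraph 5) (Set.mem_univ _)
  obtain ⟨i, hxK, hxI⟩ := exists_notMem_of_five_cycle hK hI φ
  generalize φ i = x at hxK hxI
  obtain ⟨c, hc⟩ := exists_inter_eq_singleton hKc hIc hKI hxK hxI rfl
  have hmem : ∀ v, v ∈ K ∧ v ∈ I ↔ v = c := fun v => by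
    rw [← Finset.mem_inter, hc, Finset.mem_singleton]
  obtain ⟨hcK, hcI⟩ := (hmem c).2 rfl
  -- `K ∪ I` has 5 + 5 - 1 = 9 of the ten vertices.
  have hcov : ∀ v, v ∉ K → v ∉ I → v = x := by
    have h1 := Finset.card_union_add_card_inter K I
    rw [hc, hKc, hIc, Finset.card_singleton] at h1
    have h2 : insert x (K ∪ I) = Finset.univ := by
      refine Finset.eq_univ_of_card _ ?_
      rw [Finset.card_insert_of_notMem (by simp [hxK, hxI])]
      simp; omega
    intro v hvK hvI
    have := Finset.mem_univ v
    rw [← h2] at this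
    simpa [hvK, hvI] using this
  obtain ⟨a₁, a₂, b₁, b₂, ha₁, ha₂, hb₁, hb₂, ⟨h11, h22, h12, h21⟩, hx1, hx2, hx3, hx4⟩ :=
    exists_path_of_five_cycle hK hI hcov φ
  have ha : a₁ ≠ a₂ := fun e => h21 (e ▸ h11)
  have hb : b₁ ≠ b₂ := fun e => h12 (e ▸ h11)
  -- The 5-cycle avoids `c`, so two vertices are left in each of `K` and `I` besides `c` and the
  -- cycle.
  have hca₁ : a₁ ≠ c := fun e => ha₁.2 (e ▸ hcI)
  have hca₂ : a₂ ≠ c := fun e => ha₂.2 (e ▸ hcI)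
  have hcb₁ : b₁ ≠ c := fun e => hb₁.2 (e ▸ hcK)
  have hcb₂ : b₂ ≠ c := fun e => hb₂.2 (e ▸ hcK)
  obtain ⟨a₃, a₄, h34, hA⟩ : ∃ a₃ a₄, a₃ ≠ a₄ ∧ ((K.erase c).erase a₁).erase a₂ = {a₃, a₄} := by
    rw [← Finset.card_eq_two, Finset.card_erase_of_mem, Finset.card_erase_of_mem,
      Finset.card_erase_of_mem hcK, hKc] <;> simp [*]
    exact ha.symm
  obtain ⟨b₃, b₄, g34, hB⟩ : ∃ b₃ b₄, b₃ ≠ b₄ ∧ ((I.erase c).erase b₁).erase b₂ = {b₃, b₄} := by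
    rw [← Finset.card_eq_two, Finset.card_erase_of_mem, Finset.card_erase_of_mem,
      Finset.card_erase_of_mem hcI, hIc] <;> simp [*]
    exact hb.symm
  have hA' : ∀ v, v ∈ ({a₃, a₄} : Finset (Fin 10)) → v ≠ a₂ ∧ v ≠ a₁ ∧ v ≠ c ∧ v ∈ K :=
    fun v hv => by rwa [← hA, Finset.mem_erase, Finset.mem_erase, Finset.mem_erase] at hv
  have hB' : ∀ v, v ∈ ({b₃, b₄} : Finset (Fin 10)) → v ≠ b₂ ∧ v ≠ b₁ ∧ v ≠ c ∧ v ∈ I :=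
    fun v hv => by rwa [← hB, Finset.mem_erase, Finset.mem_erase, Finset.mem_erase] at hv
  simp only [Finset.mem_insert, Finset.mem_singleton, forall_eq_or_imp, forall_eq] at hA' hB'
  have hnodup : (List.ofFn ![x, c, a₁, a₂, a₃, a₄, b₁, b₂, b₃, b₄]).Nodup := by
    clear hK hI hc hA hB hKI hKc hIc hG
    simp only [List.ofFn_succ, List.ofFn_zero, List.nodup_cons, List.mem_cons, List.not_mem_nil,
      Matrix.cons_val_zero, Matrix.cons_val_succ, or_false, not_or, not_false_iff, List.nodup_nil,
      and_true]
    and_intros <;> grind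
  have hcell : ∀ i j : Fin 10, i < j →
      (ten.cell i j = 0 → i ∈ ({1, 6, 7, 8, 9} : Finset (Fin 10)) ∧
        j ∈ ({1, 6, 7, 8, 9} : Finset (Fin 10)) ∨
        (i, j) ∈ ({(0, 2), (0, 3), (2, 7), (3, 6)} : Finset (Fin 10 × Fin 10))) ∧
      (ten.cell i j = 1 → i ∈ ({1, 2, 3, 4, 5} : Finset (Fin 10)) ∧
        j ∈ ({1, 2, 3, 4, 5} : Finset (Fin 10)) ∨
        (i, j) ∈ ({(0, 6), (0, 7), (2, 6), (3, 7)} : Finset (Fin 10 × Fin 10))) := by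
    decide +kernel
  have hKl : ∀ i ∈ ({1, 2, 3, 4, 5} : Finset (Fin 10)),
      ![x, c, a₁, a₂, a₃, a₄, b₁, b₂, b₃, b₄] i ∈ K := by
    simp [hcK, hA', ha₁, ha₂]
  have hIl : ∀ i ∈ ({1, 6, 7, 8, 9} : Finset (Fin 10)),
      ![x, c, a₁, a₂, a₃, a₄, b₁, b₂, b₃, b₄] i ∈ I := by
    simp [hcI, hB', hb₁, hb₂]
  refine exists_iso_of_list (by decide +kernel) (by simp) _ hnodup fun i j hij =>
    ⟨fun h => ?_, fun h => ?_⟩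
  · rcases (hcell i j hij).1 h with ⟨hi, hj⟩ | h
    · exact hI _ (hIl i hi) _ (hIl j hj)
    · simp only [Finset.mem_insert, Finset.mem_singleton, Prod.mk.injEq] at h
      rcases h with ⟨rfl, rfl⟩ | ⟨rfl, rfl⟩ | ⟨rfl, rfl⟩ | ⟨rfl, rfl⟩ <;> assumption
  · rcases (hcell i j hij).2 h with ⟨hi, hj⟩ | h
    · exact hK _ (hKl i hi) _ (hKl j hj) fun e => hij.ne (List.nodup_ofFn.1 hnodup e)
    · simp only [Finset.mem_insert, Finset.mem_singleton, Prod.mk.injEq] at h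
      rcases h with ⟨rfl, rfl⟩ | ⟨rfl, rfl⟩ | ⟨rfl, rfl⟩ | ⟨rfl, rfl⟩ <;> assumption

end Pattern

/-! ### The table -/

/-- A nonzero count provides a universal graph of order `n`, so no explicit one has to be exhibited.
-/
theorem f_eq_and_F_eq {k n c : ℕ}
    (hlow : ∀ (l : ℕ) (G : SimpleGraph (Fin l)), IsInducedUniversal (allGraphs k) G → n ≤ l)
    (hcard : Nat.card (Quotient (isoSetoid k n)) = c) (hc : c ≠ 0) : f k = n ∧ F k = c := by
  have : Nonempty (Quotient (isoSetoid k n)) := (Nat.card_ne_zero.1 (hcard ▸ hc)).1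
  obtain ⟨q⟩ := this
  have hf : f k = n := by
    refine le_antisymm ?_ (hlow _ _ (f_isLeast k).1.choose_spec)
    induction q using Quotient.inductionOn with
    | h G => exact (f_isLeast k).2 ⟨G.1, G.2⟩
  refine ⟨hf, ?_⟩
  rw [F, hf, hcard]

theorem two_mul_le_add_one {k l : ℕ} (G : SimpleGraph (Fin l))
    (hG : IsInducedUniversal (allGraphs k) G) : 2 * k ≤ l + 1 := by
  obtain ⟨K, I, hKc, hIc, -, -, hKI⟩ := hG.exists_clique_indep
  simpa using two_mul_le_card_add_one hKc hIc hKI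

theorem eight_le {l : ℕ} (G : SimpleGraph (Fin l)) (hG : IsInducedUniversal (allGraphs 4) G) :
    8 ≤ l := by
  obtain ⟨K, I, hKc, hIc, hK, hI, hKI⟩ := hG.exists_clique_indep
  obtain ⟨φ⟩ := hG (SimpleGraph.cycleGraph 4) (Set.mem_univ _)
  obtain ⟨i, hxK, hxI⟩ := exists_notMem_of_four_cycle hK hI φ
  simpa using two_mul_le_card hKc hIc hKI hxK hxI

theorem ten_le {l : ℕ} (G : SimpleGraph (Fin l)) (hG : IsInducedUniversal (allGraphs 5) G) :
    10 ≤ l := by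
  obtain ⟨K, I, hKc, hIc, hK, hI, hKI⟩ := hG.exists_clique_indep
  obtain ⟨φ⟩ := hG (SimpleGraph.cycleGraph 5) (Set.mem_univ _)
  obtain ⟨i, hxK, hxI⟩ := exists_notMem_of_five_cycle hK hI φ
  simpa using two_mul_le_card hKc hIc hKI hxK hxI

open Pattern

/-- Every graph on `n ≤ 5` vertices is a member of the complete family. -/
theorem exists_iso_complete {n m : ℕ} (hT : complete.Valid n m)
    (h2 : ∀ j < n, ∀ i < j, 2 ≤ complete.cell i j) (G : SimpleGraph (Fin n)) :
    ∃ p < 2 ^ m, Nonempty (complete.graph n p ≃g G) := by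
  obtain ⟨p, hp, rfl⟩ := exists_graph_eq hT G fun i j hij => by
    have := h2 j j.2 i hij
    constructor <;> intro <;> omega
  exact ⟨p, hp, ⟨SimpleGraph.Iso.refl⟩⟩

theorem card_quotient_zero : Nat.card (Quotient (isoSetoid 0 0)) = 1 :=
  card_quotient (T := complete) (m := 0) (P := complete) (l := 0) (ks := []) (vs := [])
    (hs := [0]) (syms := []) rfl (by decide) (by decide) (by decide +kernel) rfl (by decide)
    (by simp) (fun G _ => exists_iso_complete (by decide) (by decide) G) (by decide +kernel)

theorem card_quotient_one : Nat.card (Quotient (isoSetoid 1 1)) = 1 :=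
  card_quotient (T := complete) (m := 0) (P := complete) (l := 0) (ks := [0]) (vs := [0])
    (hs := [0]) (syms := []) rfl (by decide) (by decide) (by decide +kernel) rfl (by decide)
    (by simp) (fun G _ => exists_iso_complete (by decide) (by decide) G) (by decide +kernel)

theorem card_quotient_two : Nat.card (Quotient (isoSetoid 2 3)) = 2 :=
  card_quotient (T := complete) (m := 3) (P := complete) (l := 1) (ks := [0, 1]) (vs := [0, 1, 2])
    (hs := [0, 1]) (syms := []) rfl (by decide +kernel) (by decide +kernel) (by decide +kernel) rfl
    (by decide +kernel) (by simp)
    (fun G _ => exists_iso_complete (by decide +kernel) (by decide +kernel) G) (by decide +kernel)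

/-- Five vertices give only `2 ^ 10` labelled graphs, so neither structure nor symmetry breaking is
needed. -/
theorem card_quotient_three : Nat.card (Quotient (isoSetoid 3 5)) = 5 :=
  card_quotient (T := complete) (m := 10) (P := complete) (l := 3) (ks := [0, 1, 2])
    (vs := [0, 1, 2, 3, 4]) (hs := [0, 1, 3, 7]) (syms := []) rfl (by decide +kernel)
    (by decide +kernel) (by decide +kernel) rfl (by decide +kernel) (by simp)
    (fun G _ => exists_iso_complete (by decide +kernel) (by decide +kernel) G) (by decide +kernel)

/-- Interchanges of vertices of the clique and of the independent set in `Pattern.eight`. -/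
def eightSymmetries : List (List ℕ) :=
  [[0, 1, 3, 2, 4, 5, 6, 7], [0, 1, 2, 4, 3, 5, 6, 7], [0, 1, 2, 3, 4, 6, 5, 7],
    [0, 1, 2, 3, 4, 5, 7, 6]]

theorem card_quotient_four : Nat.card (Quotient (isoSetoid 4 8)) = 438 :=
  card_quotient (T := eight) (m := 16) (P := complete) (l := 6) (ks := [0, 1, 2, 3])
    -- The eleven graphs on four vertices; `12` and `30` encode two disjoint edges and the 4-cycle,
    -- the only ones that are not split.
    (vs := [0, 1, 2, 3, 4, 5, 6, 7]) (hs := [12, 30, 0, 1, 3, 7, 11, 13, 15, 31, 63])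
    (syms := eightSymmetries) rfl (by decide +kernel) (by decide +kernel) (by decide +kernel) rfl
    (by decide +kernel) (by decide +kernel) (fun _ => exists_iso_eight) (by decide +kernel)

/-- Interchanges of vertices of the clique and of the independent set in `Pattern.ten`. -/
def tenSymmetries : List (List ℕ) :=
  [[0, 1, 2, 3, 5, 4, 6, 7, 8, 9], [0, 1, 2, 3, 4, 5, 6, 7, 9, 8], [0, 1, 3, 2, 4, 5, 7, 6, 8, 9]]

theorem card_quotient_five : Nat.card (Quotient (isoSetoid 5 10)) = 22 :=
  card_quotient (T := ten) (m := 17) (P := complete) (l := 10) (ks := [0, 1, 2, 3, 4])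
    (vs := [0, 1, 2, 3, 4, 5, 6, 7, 8, 9])
    (hs := [222, 18, 1005, 801, 30, 993, 97, 734, 949, 946, 42, 909, 114, 981, 118, 951, 954, 348,
      139, 386, 664, 72, 905, 11, 221, 1023, 63, 0, 960, 271, 959, 391, 632, 64])
    -- Two of the symmetries swap vertices off the 5-cycle; the third reflects the cycle in `x`,
    -- exchanging 2 with 3 and 6 with 7 together so that the prescribed edges are kept.
    (syms := tenSymmetries) rfl (by decide +kernel) (by decide +kernel) (by decide +kernel) rfl
    (by decide +kernel) (by decide +kernel) (fun _ => exists_iso_ten) (by decide +kernel)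

end InducedUniversal

theorem mainTheorem4 :
    (InducedUniversal.f 0 = 0 ∧ InducedUniversal.F 0 = 1) ∧
    (InducedUniversal.f 1 = 1 ∧ InducedUniversal.F 1 = 1) ∧
    (InducedUniversal.f 2 = 3 ∧ InducedUniversal.F 2 = 2) ∧
    (InducedUniversal.f 3 = 5 ∧ InducedUniversal.F 3 = 5) ∧
    (InducedUniversal.f 4 = 8 ∧ InducedUniversal.F 4 = 438) ∧
    (InducedUniversal.f 5 = 10 ∧ InducedUniversal.F 5 = 22) := by
  open InducedUniversal in
  refine ⟨f_eq_and_F_eq (fun l G _ => Nat.zero_le l) card_quotient_zero (by norm_num),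
    f_eq_and_F_eq (fun l G hG => ?_) card_quotient_one (by norm_num),
    f_eq_and_F_eq (fun l G hG => ?_) card_quotient_two (by norm_num),
    f_eq_and_F_eq (fun l G hG => ?_) card_quotient_three (by norm_num),
    f_eq_and_F_eq (fun l G hG => eight_le G hG) card_quotient_four (by norm_num),
    f_eq_and_F_eq (fun l G hG => ten_le G hG) card_quotient_five (by norm_num)⟩
  all_goals
    have := InducedUniversal.two_mul_le_add_one G hG
    omega
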